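/- **Theorem (GP-UCB regret on a compact convex domain).** Let $a,b,r,\sigma>0$, $\delta\in(0,1)$, $d\in\mathbb N$, and let $D\subset[0,r]^d$ be compact and convex (for example $D\subset[0,1]^d$ with $r=1$, or with any $r\ge 1$). Let $f$ be a Gaussian process on $D$ with mean zero and covariance $k$, where $k(x,x)\le 1$ for all $x\in D$. Suppose that almost all sample paths are differentiable on $D$ and that $$\Pr\Bigl\{\sup_{x\in D}\Bigl|\frac{\partial f}{\partial x_j}(x)\Bigr|>L\Bigr\}\le a\,e^{-(L/b)^2}\qquad (j=1,\dots,d,\ L>0).$$ Observations are $y_t=f(x_t)+\varepsilon_t$ with $\varepsilon_t$ i.i.d. $\mathcal N(0,\sigma^2)$, independent of $f$. For $t\ge1$ put $$\beta_t=2\log\Bigl(\frac{t^2\pi^2}{3\delta}\Bigr)+2d\log\Bigl(t^2\,d\,b\,r\sqrt{\log(4da/\delta)}\Bigr),$$ with the conventions $\sqrt u=0$ for $u<0$ and $\log 0=0$. GP-UCB chooses $x_t$ as a (measurable) function of the data $(x_s,y_s)_{s<t}$ with $$x_t\in\arg\max_{x\in D}\ \mu_{t-1}(x)+\sqrt{\beta_t}\,\sigma_{t-1}(x),$$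 where, with $X=(x_1,\dots,x_{t-1})$, $y=(y_1,\dots,y_{t-1})^\top$ and $K=(k(x_i,x_j))_{i,j<t}$, the posterior mean and variance are $\mu_{t-1}(x)=k(x,X)(K+\sigma^2I)^{-1}y$ and $\sigma_{t-1}^2(x)=k(x,x)-k(x,X)(K+\sigma^2I)^{-1}k(X,x)$. Let $R_T=\sum_{t=1}^T\bigl(\max_D f-f(x_t)\bigr)$, $C_1=8/\log(1+\sigma^{-2})$, and let $\gamma_T=\sup_{A\subset D,\,|A|=T}I(\mathbf y_A;f_A)$ be the maximum information gain, where $\mathbf y_A$ is $f_A$ plus independent $\mathcal N(0,\sigma^2)$ noise, $I$ is the mutual information in nats, and $\sup\emptyset=0$. Then for every $v>0$ there is a constant $C>0$ depending only on $a,b,r,\delta,\sigma,v$ (not on $d$, $D$, $k$ or $T$) such that, with probability at least $1-\delta$, for all $T\ge1$ simultaneously $$R_T\le 2\sqrt{C_1\,T\,\beta_T\,\gamma_T}+\frac{\pi^2}{6},$$ and, if $k(x,x)\ge v$ for some $x\in D$, also $R_T\le C\sqrt{d\,T\,\gamma_T}\,\sqrt{\log(dT+1)}$; that is, $R_T=\mathcal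 O^*(\sqrt{d\,T\,\gamma_T})$ up to logarithmic factors. -/

import Mathlib

open MeasureTheory ProbabilityTheory

open scoped ENNReal

noncomputable section

namespace GPUCB

/-- The ambient space `ℝ^d`. -/
abbrev Pt (d : ℕ) : Type := EuclideanSpace ℝ (Fin d)

/-- The matrix `K + σ² I`, where `K` is the kernel matrix of the points `X`. -/
def noisyGram {d n : ℕ} (k : Pt d → Pt d → ℝ) (σ : ℝ) (X : Fin n → Pt d) :
    Matrix (Fin n) (Fin n) ℝ :=
  Matrix.of (fun i j => k (X i) (X j)) + σ ^ 2 • (1 : Matrix (Fin n) (Fin n) ℝ)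

/-- GP posterior mean at `z` given the observations `Y` at the points `X` (zero prior mean). -/
def postMean {d n : ℕ} (k : Pt d → Pt d → ℝ) (σ : ℝ) (X : Fin n → Pt d) (Y : Fin n → ℝ)
    (z : Pt d) : ℝ :=
  (fun i => k z (X i)) ⬝ᵥ ((noisyGram k σ X)⁻¹.mulVec Y)

/-- GP posterior variance at `z` given noisy observations at the points `X`. -/
def postVar {d n : ℕ} (k : Pt d → Pt d → ℝ) (σ : ℝ) (X : Fin n → Pt d) (z : Pt d) : ℝ :=
  k z z - (fun i => k z (X i)) ⬝ᵥ ((noisyGram k σ X)⁻¹.mulVec (fun i => k (X i) z))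

/-- GP posterior standard deviation. -/
def postSD {d n : ℕ} (k : Pt d → Pt d → ℝ) (σ : ℝ) (X : Fin n → Pt d) (z : Pt d) : ℝ :=
  √(postVar k σ X z)

/-- The confidence parameter
`β_t = 2 log (t² π² / (3δ)) + 2 d log (t² d b r √(log (4 d a / δ)))`. -/
def beta (d : ℕ) (a b r δ : ℝ) (t : ℕ) : ℝ :=
  2 * Real.log ((t : ℝ) ^ 2 * Real.pi ^ 2 / (3 * δ)) +
    2 * d * Real.log ((t : ℝ) ^ 2 * d * b * r * √(Real.log (4 * d * a / δ)))

/-- Mutual information (in nats) of two random variables: the Kullback-Leibler divergence of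
their joint law from the product of their marginal laws. -/
def mutualInfo {Ω α β : Type*} [MeasurableSpace Ω] [MeasurableSpace α] [MeasurableSpace β]
    (P : Measure Ω) (U : Ω → α) (V : Ω → β) : ℝ≥0∞ :=
  InformationTheory.klDiv (P.map (fun ω => (U ω, V ω))) ((P.map U).prod (P.map V))

/-- Maximum information gain `γ_T`: the supremum, over all sets `A ⊆ D` of `T` distinct points
(enumerated injectively by `Fin T`), of the mutual information between the noisy observations
at `A` and the values of `f` at `A`. -/
def maxInfoGain {d : ℕ} {Ω : Type*} [MeasurableSpace Ω] (P : Measure Ω)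
    (f : Pt d → Ω → ℝ) (ε : ℕ → Ω → ℝ) (D : Set (Pt d)) (T : ℕ) : ℝ≥0∞ :=
  ⨆ (A : Fin T → Pt d) (_ : Function.Injective A) (_ : ∀ i, A i ∈ D),
    mutualInfo P (fun ω i => f (A i) ω + ε i ω) (fun ω i => f (A i) ω)

/-- `f` restricted to `D` is a Gaussian process with mean zero and covariance `k`, and `ε` is an
i.i.d. sequence of `N(0, σ²)` noise variables that is independent of `f`. -/
structure IsGPModel {d : ℕ} {Ω : Type*} [MeasurableSpace Ω] (P : Measure Ω)
    (f : Pt d → Ω → ℝ) (ε : ℕ → Ω → ℝ) (D : Set (Pt d)) (k : Pt d → Pt d → ℝ) (σ : ℝ) :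
    Prop where
  measurable_f : ∀ x ∈ D, Measurable (f x)
  gaussian : IsGaussianProcess (fun (x : D) ω => f x ω) P
  mean_zero : ∀ x ∈ D, ∫ ω, f x ω ∂P = 0
  covariance_eq : ∀ x ∈ D, ∀ x' ∈ D, cov[f x, f x'; P] = k x x'
  measurable_noise : ∀ n, Measurable (ε n)
  noise_law : ∀ n, P.map (ε n) = gaussianReal 0 (Real.toNNReal (σ ^ 2))
  noise_indep : iIndepFun ε P
  indep : IndepFun (fun ω (x : D) => f x ω) (fun ω n => ε n ω) P

/-- Almost every sample path is differentiable on `D`, with partial derivatives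
`∂f/∂x_j = G x ω j` (derivatives are taken within `D`, so one-sided ones at the boundary suffice),
and `P (sup_{x ∈ D} |∂f/∂x_j| > L) ≤ a exp (-(L/b)²)` for all `j` and all `L > 0`. -/
structure HasPartialTails {d : ℕ} {Ω : Type*} [MeasurableSpace Ω] (P : Measure Ω)
    (f : Pt d → Ω → ℝ) (G : Pt d → Ω → Pt d) (D : Set (Pt d)) (a b : ℝ) : Prop where
  hasGradient : ∀ᵐ ω ∂P, ∀ x ∈ D, HasGradientWithinAt (fun z => f z ω) (G x ω) D x
  tail : ∀ j : Fin d, ∀ L : ℝ, 0 < L →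
    P {ω | ENNReal.ofReal L < ⨆ x ∈ D, ‖G x ω j‖ₑ} ≤ ENNReal.ofReal (a * Real.exp (-(L / b) ^ 2))

/-- A run of GP-UCB on `D`. Indices start at `0`: `x n` and `y n` are the query and the observation
of round `n + 1`. The query is a measurable function `pol n` of the data observed so far, and it
maximizes over `D` the acquisition function `μ_n + √β_{n+1} σ_n`, where `μ_n` and `σ_n` are the
posterior mean and standard deviation given these data. -/
structure IsRun {d : ℕ} {Ω : Type*} (f : Pt d → Ω → ℝ) (ε : ℕ → Ω → ℝ)
    (D : Set (Pt d)) (k : Pt d → Pt d → ℝ) (σ : ℝ) (β : ℕ → ℝ)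
    (pol : (n : ℕ) → (Fin n → Pt d × ℝ) → Pt d) (x : ℕ → Ω → Pt d) (y : ℕ → Ω → ℝ) : Prop where
  measurable_pol : ∀ n, Measurable (pol n)
  query : ∀ n ω, x n ω = pol n (fun i => (x i ω, y i ω))
  observe : ∀ n ω, y n ω = f (x n ω) ω + ε n ω
  mem : ∀ n ω, x n ω ∈ D
  isMax : ∀ n ω, IsMaxOn
    (fun z => postMean k σ (fun i : Fin n => x i ω) (fun i => y i ω) z +
      √(β (n + 1)) * postSD k σ (fun i : Fin n => x i ω) z) D (x n ω)

/-- Cumulative regret `R_T = ∑_{t ≤ T} (max_D f - f (x_t))` on the outcome `ω`. -/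
def regret {d : ℕ} {Ω : Type*} (f : Pt d → Ω → ℝ) (D : Set (Pt d)) (x : ℕ → Ω → Pt d)
    (T : ℕ) (ω : Ω) : ℝ :=
  ∑ n ∈ Finset.range T, (sSup ((fun z => f z ω) '' D) - f (x n ω) ω)

end GPUCB

end

/-!
The regret of round `t` is bounded by comparing `f` with its posterior confidence bounds: if `f`
lies below its upper confidence bound at (a point near) the maximizer and above its lower
confidence bound at the query `x_t`, then, since `x_t` maximizes the upper confidence bound, the
regret is at most `2 √β_t σ_{t-1}(x_t)` plus a discretization error.

*Confidence bounds.* The queries depend on the past observations, so the posterior at the observed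
data cannot be read off from the joint Gaussian law of finitely many fixed observations. Instead,
the prior is moved to path space (`isGPEval_path`), where for each fixed path the observations
have an explicit density: the map from noise to observations is triangular with unit diagonal, so
the density is the product of Gaussian densities centred at the values of the path at the points
that the observations themselves select (`lintegral_obsOf`). After exchanging the integrals over
paths and over data, the data `y` and hence the design are fixed, and Bayes' rule for a fixed
design applies. It is needed at every `y`, not almost every `y`; this follows from the
independence of the residual and the observations by continuity in `y` (`posterior_map`). The
result is the Gaussian tail bound with factor `1/2` at any point chosen from the data
(`run_tail`). Joint measurability of the evaluation and continuity of the kernel come from the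
continuity of the paths (`continuous_kernel`).

*Discretization.* Outside an event of probability `δ / 4` all partial derivatives are at most `L =
b √(log (4 d a / δ))`. In round `t` the upper confidence bounds are used only on a net of at most
`τ_t ^ d` points with `τ_t = t² d r L` (`exists_net`), which leaves an error of `1 / t²`. As long
as `τ_t < 1` no net is needed, as `f` oscillates by at most `d L r < 1 / t²`; this takes care of
the rounds in which `β_t` may be negative. The failure probabilities of round `t` are summed
against `∑ 1 / t² = π² / 6` (`exists_good_event`).

*Information gain.* For a Gaussian vector observed in noise the mutual information is `log det (K
+ σ² I) / 2 - n log σ` (`klDiv_noisy`, by whitening the observations), and Schur complements turn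
this into `∑ log (1 + σ_{t-1}(x_t)² / σ²) / 2` (`log_det_noisyGram`). The maximum information gain
ranges over distinct points, whereas the algorithm may repeat queries; tuples of distinct points
are dense in a convex domain with more than one point, so by continuity repetitions gain nothing
(`sum_log_le_maxInfoGain`). On a one-point domain the regret is zero. The first bound then follows
from the Cauchy–Schwarz inequality and concavity of the logarithm (`sum_width_le`).

*Second bound.* It follows from `β_T ≤ C d log (d T + 1)` (`beta_le`) and from the lower bound
`log (1 + v / σ²) / 2` for the information gain (`log_le_maxInfoGain`), which absorbs `π² / 6`.
-/

namespace GPUCB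

/-! ### The law of observations collected along an adaptive design -/

/-- The history (queries paired with observations) produced by the query rule `p` when the
observations are `y`: the query of each round is computed from the previous rounds. -/
def hist {α : Type*} (p : (n : ℕ) → (Fin n → α × ℝ) → α) :
    (n : ℕ) → (Fin n → ℝ) → Fin n → α × ℝ
  | 0, _ => Fin.elim0
  | n + 1, y => Fin.snoc (α := fun _ => α × ℝ) (hist p n (Fin.init y))
      (p n (hist p n (Fin.init y)), y (Fin.last n))

/-- The observations produced by the query rule `p` on the objective `h` with noise `e`. -/
def obsOf {α : Type*} (p : (n : ℕ) → (Fin n → α × ℝ) → α) (h : α → ℝ) :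
    (n : ℕ) → (Fin n → ℝ) → Fin n → ℝ
  | 0, _ => Fin.elim0
  | n + 1, e => Fin.snoc (α := fun _ => ℝ) (obsOf p h n (Fin.init e))
      (h (p n (hist p n (obsOf p h n (Fin.init e)))) + e (Fin.last n))

variable {α : Type*} {p : (n : ℕ) → (Fin n → α × ℝ) → α}

lemma hist_succ_snoc (n : ℕ) (y : Fin n → ℝ) (t : ℝ) :
    hist p (n + 1) (Fin.snoc (α := fun _ => ℝ) y t) =
      Fin.snoc (α := fun _ => α × ℝ) (hist p n y) (p n (hist p n y), t) := by
  simp [hist]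

lemma obsOf_succ_snoc (h : α → ℝ) (n : ℕ) (e : Fin n → ℝ) (t : ℝ) :
    obsOf p h (n + 1) (Fin.snoc (α := fun _ => ℝ) e t) =
      Fin.snoc (α := fun _ => ℝ) (obsOf p h n e) (h (p n (hist p n (obsOf p h n e))) + t) := by
  simp [obsOf]

lemma measurable_snoc {β γ : Type*} [MeasurableSpace β] [MeasurableSpace γ] {n : ℕ}
    {f : γ → Fin n → β} {g : γ → β} (hf : Measurable f) (hg : Measurable g) :
    Measurable fun c => (Fin.snoc (α := fun _ => β) (f c) (g c) : Fin (n + 1) → β) := by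
  refine measurable_pi_lambda _ fun i => ?_
  refine Fin.lastCases ?_ (fun j => ?_) i
  · simpa using hg
  · simpa [Function.comp_def] using (measurable_pi_apply j).comp hf

lemma measurable_init {β : Type*} [MeasurableSpace β] {n : ℕ} :
    Measurable fun y : Fin (n + 1) → β => (Fin.init (α := fun _ => β) y : Fin n → β) :=
  measurable_pi_lambda _ fun i => measurable_pi_apply (Fin.castSucc i)

lemma measurable_hist [MeasurableSpace α] (hp : ∀ n, Measurable (p n)) (n : ℕ) :
    Measurable (hist p n) := by
  induction n with
  | zero => exact measurable_of_subsingleton_codomain _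
  | succ n ih =>
    have h1 : Measurable fun y : Fin (n + 1) → ℝ => hist p n (Fin.init y) :=
      ih.comp measurable_init
    exact measurable_snoc h1 (((hp n).comp h1).prodMk (measurable_pi_apply _))

lemma measurable_obsOf [MeasurableSpace α] (hp : ∀ n, Measurable (p n)) {h : α → ℝ}
    (hh : Measurable h) (n : ℕ) : Measurable (obsOf p h n) := by
  induction n with
  | zero => exact measurable_of_subsingleton_codomain _
  | succ n ih =>
    have h1 : Measurable fun y : Fin (n + 1) → ℝ => obsOf p h n (Fin.init y) :=
      ih.comp measurable_init
    exact measurable_snoc h1 ((hh.comp ((hp n).comp ((measurable_hist hp n).comp h1))).add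
      (measurable_pi_apply _))

/-- Joint measurability of the observations in the objective (through a parameter `w`) and the
noise. -/
lemma measurable_obsOf_uncurry [MeasurableSpace α] {W : Type*} [MeasurableSpace W]
    (hp : ∀ n, Measurable (p n)) {h : W → α → ℝ}
    (hh : Measurable (Function.uncurry h)) (n : ℕ) :
    Measurable fun q : W × (Fin n → ℝ) => obsOf p (h q.1) n q.2 := by
  induction n with
  | zero => exact measurable_of_subsingleton_codomain _
  | succ n ih =>
    have h1 : Measurable fun q : W × (Fin (n + 1) → ℝ) => obsOf p (h q.1) n (Fin.init q.2) :=
      ih.comp (measurable_fst.prodMk (measurable_init.comp measurable_snd))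
    refine measurable_snoc h1 (Measurable.add ?_ ((measurable_pi_apply _).comp measurable_snd))
    exact hh.comp (measurable_fst.prodMk ((hp n).comp ((measurable_hist hp n).comp h1)))

/-- Fubini's theorem, splitting off the last coordinate. -/
lemma lintegral_pi_succ (μ : Measure ℝ) [SigmaFinite μ] {n : ℕ} {F : (Fin (n + 1) → ℝ) → ℝ≥0∞}
    (hF : Measurable F) :
    ∫⁻ x, F x ∂(Measure.pi fun _ => μ) =
      ∫⁻ x, ∫⁻ t, F (Fin.snoc (α := fun _ => ℝ) x t) ∂μ ∂(Measure.pi fun _ => μ) := by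
  have hmp := (measurePreserving_piFinSuccAbove (fun _ : Fin (n + 1) => μ) (Fin.last n)).symm
  rw [← hmp.lintegral_comp hF, lintegral_prod_symm _ (by fun_prop)]
  simp [MeasurableEquiv.piFinSuccAbove, Fin.insertNthEquiv, Fin.insertNth_last']

/-- For a fixed objective `h`, the observations have a density with respect to Lebesgue measure:
the product of the Gaussian densities centred at the values of `h` at the queries which these
very observations produce. The map from noise to observations is triangular with unit diagonal,
so no Jacobian appears, however the queries depend on the past. -/
lemma lintegral_obsOf [MeasurableSpace α] (hp : ∀ n, Measurable (p n)) {h : α → ℝ}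
    (hh : Measurable h) {v : NNReal} (hv : v ≠ 0) (n : ℕ) {F : (Fin n → ℝ) → ℝ≥0∞}
    (hF : Measurable F) :
    ∫⁻ e, F (obsOf p h n e) ∂(Measure.pi fun _ => gaussianReal 0 v) =
      ∫⁻ y, F y * ∏ i, gaussianPDF (h (hist p n y i).1) v (y i) := by
  induction n with
  | zero =>
    have : (volume : Measure (Fin 0 → ℝ)) = Measure.pi fun _ => gaussianReal 0 v := by
      rw [volume_pi, Measure.pi_of_empty _ Fin.elim0, Measure.pi_of_empty _ Fin.elim0]
    rw [this]
    refine lintegral_congr fun e => ?_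
    simp [Subsingleton.elim (obsOf p h 0 e) e]
  | succ n ih =>
    have hmeasH := measurable_hist hp n
    have hmH1 := measurable_hist hp (n + 1)
    have hobs := measurable_obsOf hp hh (n + 1)
    rw [lintegral_pi_succ (F := fun e => F (obsOf p h (n + 1) e)) _ (hF.comp hobs)]
    have hin : ∀ e : Fin n → ℝ,
        ∫⁻ t, F (obsOf p h (n + 1) (Fin.snoc (α := fun _ => ℝ) e t)) ∂gaussianReal 0 v =
          (fun y : Fin n → ℝ => ∫⁻ t, F (Fin.snoc (α := fun _ => ℝ) y t) *
            gaussianPDF (h (p n (hist p n y))) v t) (obsOf p h n e) := by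
      intro e
      simp only [obsOf_succ_snoc]
      set y := obsOf p h n e
      set c := h (p n (hist p n y))
      have hFm : Measurable fun t : ℝ => F (Fin.snoc (α := fun _ => ℝ) y t) :=
        hF.comp (measurable_snoc measurable_const measurable_id)
      have := gaussianReal_map_const_add (μ := 0) (v := v) c
      rw [zero_add] at this
      rw [← lintegral_map (f := fun t => F (Fin.snoc (α := fun _ => ℝ) y t)) hFm
        (measurable_const_add c), this, gaussianReal_of_var_ne_zero _ hv,
        lintegral_withDensity_eq_lintegral_mul _ (measurable_gaussianPDF _ _) hFm]
      exact lintegral_congr fun t => mul_comm _ _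
    have hFy : ∀ y : Fin n → ℝ, Measurable fun t : ℝ => F (Fin.snoc (α := fun _ => ℝ) y t) :=
      fun y => hF.comp (measurable_snoc measurable_const measurable_id)
    have hpdf : Measurable fun q : (Fin n → ℝ) × ℝ => gaussianPDF (h (p n (hist p n q.1))) v q.2 :=
      measurable_uncurry_gaussianPDF.comp ((hh.comp ((hp n).comp
        (hmeasH.comp measurable_fst))).prodMk (measurable_const.prodMk measurable_snd))
    have hFs : Measurable fun q : (Fin n → ℝ) × ℝ => F (Fin.snoc (α := fun _ => ℝ) q.1 q.2) :=
      hF.comp (measurable_snoc measurable_fst measurable_snd)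
    simp only [hin]
    rw [ih (F := fun y : Fin n → ℝ => ∫⁻ t, F (Fin.snoc (α := fun _ => ℝ) y t) *
            gaussianPDF (h (p n (hist p n y))) v t)
      (Measurable.lintegral_prod_right' (f := fun q : (Fin n → ℝ) × ℝ => _ * _) (hFs.mul hpdf)),
      show (volume : Measure (Fin (n + 1) → ℝ)) = Measure.pi fun _ => volume from volume_pi,
      show (volume : Measure (Fin n → ℝ)) = Measure.pi fun _ => volume from volume_pi,
      lintegral_pi_succ]
    · refine lintegral_congr fun y => ?_
      rw [← lintegral_mul_const]
      · refine lintegral_congr fun t => ?_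
        simp only [hist_succ_snoc, Fin.prod_univ_castSucc, Fin.snoc_castSucc, Fin.snoc_last]
        ring
      · exact (hFy y).mul (measurable_gaussianPDF _ _)
    · refine hF.mul (Finset.measurable_prod _ fun i _ => ?_)
      exact measurable_uncurry_gaussianPDF.comp ((hh.comp (measurable_fst.comp
        ((measurable_pi_apply i).comp hmH1))).prodMk
        (measurable_const.prodMk (measurable_pi_apply i)))

/-! ### Gaussian regression -/

section Regression

open Matrix

variable {Ω : Type*} [MeasurableSpace Ω] {P : Measure Ω} {n : ℕ}

lemma hasGaussianLaw_residual {u : Ω → ℝ} {Y : Fin n → Ω → ℝ}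
    (hG : HasGaussianLaw (fun ω => (u ω, fun i => Y i ω)) P) (m : Fin n → ℝ) :
    HasGaussianLaw (fun ω => (u ω - m ⬝ᵥ (fun i => Y i ω), fun i => Y i ω)) P := by
  let L : (ℝ × (Fin n → ℝ)) →L[ℝ] (ℝ × (Fin n → ℝ)) :=
    ((ContinuousLinearMap.fst ℝ ℝ (Fin n → ℝ)) - (∑ i, m i • (ContinuousLinearMap.proj i).comp
      (ContinuousLinearMap.snd ℝ ℝ (Fin n → ℝ)))).prod (ContinuousLinearMap.snd ℝ ℝ (Fin n → ℝ))
  have := hG.map_fun L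
  have hL : ∀ q, L q = (q.1 - m ⬝ᵥ q.2, q.2) := fun q => by
    simp [L, dotProduct]
  simpa only [hL] using this

variable [IsProbabilityMeasure P]

/-- The residual of the best linear prediction is independent of the observations. -/
lemma residual_indep {u : Ω → ℝ} {Y : Fin n → Ω → ℝ}
    (hG : HasGaussianLaw (fun ω => (u ω, fun i => Y i ω)) P)
    {M : Matrix (Fin n) (Fin n) ℝ} (hM : IsUnit M.det) (hcov : ∀ i j, cov[Y i, Y j; P] = M i j)
    {kz : Fin n → ℝ} (hkz : ∀ i, cov[u, Y i; P] = kz i) :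
    IndepFun (fun ω => u ω - kz ⬝ᵥ (M⁻¹ *ᵥ fun i => Y i ω)) (fun ω i => Y i ω) P := by
  have hY : ∀ i, MemLp (Y i) 2 P := fun i => (hG.snd.eval i).memLp_two
  have hu : MemLp u 2 P := hG.fst.memLp_two
  have hres := hasGaussianLaw_residual hG (kz ᵥ* M⁻¹)
  simp only [← dotProduct_mulVec] at hres
  have hpair : HasGaussianLaw (fun ω => ((fun _ : Unit => u ω - kz ⬝ᵥ (M⁻¹ *ᵥ fun i => Y i ω)),
      fun i => Y i ω)) P :=
    hres.map_fun ((ContinuousLinearMap.pi fun _ : Unit => ContinuousLinearMap.fst ℝ ℝ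
      (Fin n → ℝ)).prod (ContinuousLinearMap.snd ℝ ℝ (Fin n → ℝ)))
  have := hpair.indepFun_of_covariance_eval (X := fun _ : Unit => fun ω => u ω -
    kz ⬝ᵥ (M⁻¹ *ᵥ fun i => Y i ω)) (Y := Y) fun _ j => ?_
  · exact this.comp (measurable_pi_apply ()) measurable_id
  · simp only [dotProduct_mulVec]
    simp only [dotProduct]
    rw [covariance_fun_sub_left hu (memLp_finsetSum _ fun i _ => (hY i).const_mul _) (hY j),
      covariance_fun_sum_left (fun i => (hY i).const_mul _) (hY j), hkz]
    simp only [covariance_const_mul_left, hcov]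
    have : kz ᵥ* M⁻¹ ᵥ* M = kz := by
      rw [vecMul_vecMul, nonsing_inv_mul _ hM, vecMul_one]
    nth_rewrite 1 [← this]
    simp [vecMul, dotProduct]

lemma residual_variance {u : Ω → ℝ} {Y : Fin n → Ω → ℝ}
    (hG : HasGaussianLaw (fun ω => (u ω, fun i => Y i ω)) P)
    {M : Matrix (Fin n) (Fin n) ℝ} (hM : IsUnit M.det) (hcov : ∀ i j, cov[Y i, Y j; P] = M i j)
    {kz : Fin n → ℝ} (hkz : ∀ i, cov[u, Y i; P] = kz i) :
    Var[fun ω => u ω - kz ⬝ᵥ (M⁻¹ *ᵥ fun i => Y i ω); P] = Var[u; P] - kz ⬝ᵥ (M⁻¹ *ᵥ kz) := by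
  have hY : ∀ i, MemLp (Y i) 2 P := fun i => (hG.snd.eval i).memLp_two
  have hu : MemLp u 2 P := hG.fst.memLp_two
  have hsum : MemLp (fun ω => ∑ i, (kz ᵥ* M⁻¹) i * Y i ω) 2 P :=
    memLp_finsetSum _ fun i _ => (hY i).const_mul _
  have hind := residual_indep hG hM hcov hkz
  have hind2 : IndepFun (fun ω => u ω - kz ⬝ᵥ (M⁻¹ *ᵥ fun i => Y i ω))
      (fun ω => ∑ i, (kz ᵥ* M⁻¹) i * Y i ω) P :=
    hind.comp (φ := id) (ψ := fun y : Fin n → ℝ => ∑ i, (kz ᵥ* M⁻¹) i * y i) measurable_id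
      (by fun_prop)
  simp only [dotProduct_mulVec] at hind2 ⊢
  simp only [dotProduct] at hind2 ⊢
  have hr : MemLp (fun ω => u ω - ∑ i, (kz ᵥ* M⁻¹) i * Y i ω) 2 P := hu.sub hsum
  rw [← covariance_self hr.aestronglyMeasurable.aemeasurable]
  nth_rewrite 2 [show (fun ω => u ω - ∑ i, (kz ᵥ* M⁻¹) i * Y i ω) =
    (fun ω => u ω - (fun ω => ∑ i, (kz ᵥ* M⁻¹) i * Y i ω) ω) from rfl]
  rw [covariance_fun_sub_right hr hu hsum, hind2.covariance_eq_zero hr hsum, sub_zero,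
    covariance_fun_sub_left hu hsum hu, covariance_self hu.aestronglyMeasurable.aemeasurable,
    covariance_fun_sum_left (fun i => (hY i).const_mul _) hu]
  simp only [covariance_const_mul_left]
  congr 1
  refine Finset.sum_congr rfl fun i _ => ?_
  rw [covariance_comm, hkz]

/-- The law of the residual of the best linear prediction. -/
lemma residual_law {u : Ω → ℝ} {Y : Fin n → Ω → ℝ}
    (hG : HasGaussianLaw (fun ω => (u ω, fun i => Y i ω)) P)
    (hu0 : ∫ ω, u ω ∂P = 0) (hY0 : ∀ i, ∫ ω, Y i ω ∂P = 0)
    {M : Matrix (Fin n) (Fin n) ℝ} (hM : IsUnit M.det) (hcov : ∀ i j, cov[Y i, Y j; P] = M i j)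
    {kz : Fin n → ℝ} (hkz : ∀ i, cov[u, Y i; P] = kz i) :
    P.map (fun ω => u ω - kz ⬝ᵥ (M⁻¹ *ᵥ fun i => Y i ω)) =
      gaussianReal 0 (Var[u; P] - kz ⬝ᵥ (M⁻¹ *ᵥ kz)).toNNReal := by
  have hres := (hasGaussianLaw_residual hG (kz ᵥ* M⁻¹)).fst
  simp only [← dotProduct_mulVec] at hres
  have hY : ∀ i, Integrable (Y i) P := fun i => (hG.snd.eval i).integrable
  have hu : Integrable u P := hG.fst.integrable
  rw [hres.map_eq_gaussianReal, residual_variance hG hM hcov hkz]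
  congr 1
  simp only [dotProduct_mulVec]
  simp only [dotProduct]
  rw [integral_sub hu (integrable_finsetSum _ fun i _ => (hY i).const_mul _),
    integral_finsetSum _ fun i _ => (hY i).const_mul _]
  simp [integral_const_mul, hu0, hY0]

/-- The covariance matrix of `V` plus `σ² I`. -/
noncomputable def noisyCov (P : Measure Ω) (σ : ℝ) (V : Fin n → Ω → ℝ) : Matrix (Fin n) (Fin n) ℝ :=
  Matrix.of (fun i j => cov[V i, V j; P]) + σ ^ 2 • (1 : Matrix (Fin n) (Fin n) ℝ)

lemma posSemidef_cov {V : Fin n → Ω → ℝ} (hV : ∀ i, MemLp (V i) 2 P) :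
    (Matrix.of (fun i j => cov[V i, V j; P])).PosSemidef := by
  refine .of_dotProduct_mulVec_nonneg ?_ fun x => ?_
  · ext i j
    simp [covariance_comm]
  · have h := variance_nonneg (fun ω => ∑ i, x i * V i ω) P
    have hm : MemLp (fun ω => ∑ i, x i * V i ω) 2 P :=
      memLp_finsetSum _ fun i _ => (hV i).const_mul _
    rw [← covariance_self hm.aestronglyMeasurable.aemeasurable,
      covariance_fun_sum_fun_sum (fun i => (hV i).const_mul _) fun i => (hV i).const_mul _] at h
    simp only [covariance_const_mul_left, covariance_const_mul_right] at h
    simpa [dotProduct, mulVec, Finset.mul_sum, mul_comm, mul_left_comm] using h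

lemma posDef_noisyCov {V : Fin n → Ω → ℝ} (hV : ∀ i, MemLp (V i) 2 P) {σ : ℝ} (hσ : 0 < σ) :
    (noisyCov P σ V).PosDef :=
  Matrix.PosDef.posSemidef_add (posSemidef_cov hV) (Matrix.PosDef.one.smul (by positivity))

section Noisy

variable {u : Ω → ℝ} {V e : Fin n → Ω → ℝ} {v : NNReal}

lemma isGaussian_pi_gaussianReal (n : ℕ) (v : NNReal) :
    IsGaussian (Measure.pi fun _ : Fin n => gaussianReal 0 v) := by
  have h : iIndepFun (fun (i : Fin n) (x : Fin n → ℝ) => x i)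
      (Measure.pi fun _ : Fin n => gaussianReal 0 v) :=
    iIndepFun_pi (X := fun _ x => x) fun _ => aemeasurable_id'
  have h2 : ∀ i, HasGaussianLaw (fun x : Fin n → ℝ => x i)
      (Measure.pi fun _ : Fin n => gaussianReal 0 v) := fun i =>
    ⟨by
      rw [show (fun x : Fin n → ℝ => x i) = Function.eval i from rfl,
        (measurePreserving_eval (fun _ : Fin n => gaussianReal 0 v) i).map_eq]
      infer_instance⟩
  have := (h.hasGaussianLaw h2).isGaussian_map
  rwa [show (fun (x : Fin n → ℝ) (i : Fin n) => x i) = id from rfl, Measure.map_id] at this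

omit [IsProbabilityMeasure P] in
lemma hasGaussianLaw_of_map_pi
    (he : P.map (fun ω i => e i ω) = Measure.pi fun _ => gaussianReal 0 v) :
    HasGaussianLaw (fun ω i => e i ω) P where
  isGaussian_map := by rw [he]; exact isGaussian_pi_gaussianReal n v

omit [IsProbabilityMeasure P] in
lemma map_eval_of_map_pi (hem : ∀ i, AEMeasurable (e i) P)
    (he : P.map (fun ω i => e i ω) = Measure.pi fun _ => gaussianReal 0 v) (i : Fin n) :
    P.map (e i) = gaussianReal 0 v := by
  have h := (measurePreserving_eval (fun _ : Fin n => gaussianReal 0 v) i).map_eq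
  rw [← he, AEMeasurable.map_map_of_aemeasurable
    (measurable_pi_apply i).aemeasurable (aemeasurable_pi_lambda _ hem)] at h
  exact h

omit [IsProbabilityMeasure P] in
lemma noisy_hasGaussianLaw (hG : HasGaussianLaw (fun ω => (u ω, fun i => V i ω)) P)
    (he : P.map (fun ω i => e i ω) = Measure.pi fun _ => gaussianReal 0 v)
    (hind : IndepFun (fun ω => (u ω, fun i => V i ω)) (fun ω i => e i ω) P) :
    HasGaussianLaw (fun ω => (u ω, fun i => V i ω + e i ω)) P := by
  have h := hind.hasGaussianLaw hG (hasGaussianLaw_of_map_pi he)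
  let E := Fin n → ℝ
  let L : ((ℝ × E) × E) →L[ℝ] (ℝ × E) :=
    ((ContinuousLinearMap.fst ℝ ℝ E).comp (ContinuousLinearMap.fst ℝ (ℝ × E) E)).prod
      ((ContinuousLinearMap.snd ℝ ℝ E).comp (ContinuousLinearMap.fst ℝ (ℝ × E) E) +
        ContinuousLinearMap.snd ℝ (ℝ × E) E)
  exact h.map_fun L

lemma noisy_covariance (hG : HasGaussianLaw (fun ω => (u ω, fun i => V i ω)) P)
    (hem : ∀ i, AEMeasurable (e i) P) {σ : ℝ}
    (he : P.map (fun ω i => e i ω) = Measure.pi fun _ => gaussianReal 0 (σ ^ 2).toNNReal)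
    (hind : IndepFun (fun ω => (u ω, fun i => V i ω)) (fun ω i => e i ω) P) (i j : Fin n) :
    cov[fun ω => V i ω + e i ω, fun ω => V j ω + e j ω; P] = noisyCov P σ V i j := by
  have hV : ∀ i, MemLp (V i) 2 P := fun i => (hG.snd.eval i).memLp_two
  have hE : ∀ i, MemLp (e i) 2 P := fun i =>
    ((hasGaussianLaw_of_map_pi he).eval i).memLp_two
  have hVe : ∀ i j, cov[V i, e j; P] = 0 := fun i j =>
    IndepFun.covariance_eq_zero (hind.comp (φ := fun q : ℝ × (Fin n → ℝ) => q.2 i)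
      (ψ := fun e : Fin n → ℝ => e j) (by fun_prop) (by fun_prop)) (hV i) (hE j)
  have hee : cov[e i, e j; P] = (σ ^ 2 • (1 : Matrix (Fin n) (Fin n) ℝ)) i j := by
    by_cases hij : i = j
    · subst hij
      rw [covariance_self (hem i), ← variance_id_map (hem i), map_eval_of_map_pi hem he,
        variance_id_gaussianReal]
      simp [sq_nonneg]
    · have hi : iIndepFun e P := by
        rw [iIndepFun_iff_map_fun_eq_pi_map hem, he]
        simp only [map_eval_of_map_pi hem he]
      rw [(hi.indepFun hij).covariance_eq_zero (hE i) (hE j)]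
      simp [hij]
  have h1 : cov[fun ω => V i ω + e i ω, fun ω => V j ω + e j ω; P] =
    cov[V i + e i, V j + e j; P] := rfl
  rw [h1, covariance_add_left (hV i) (hE i) ((hV j).add (hE j)),
    covariance_add_right (hV i) (hV j) (hE j), covariance_add_right (hE i) (hV j) (hE j),
    hVe, covariance_comm (e i), hVe, hee]
  simp [noisyCov]

lemma noisy_covariance_left (hG : HasGaussianLaw (fun ω => (u ω, fun i => V i ω)) P)
    (he : P.map (fun ω i => e i ω) = Measure.pi fun _ => gaussianReal 0 v)
    (hind : IndepFun (fun ω => (u ω, fun i => V i ω)) (fun ω i => e i ω) P) (i : Fin n) :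
    cov[u, fun ω => V i ω + e i ω; P] = cov[u, V i; P] := by
  have hV : ∀ i, MemLp (V i) 2 P := fun i => (hG.snd.eval i).memLp_two
  have hu : MemLp u 2 P := hG.fst.memLp_two
  have hE : ∀ i, MemLp (e i) 2 P := fun i =>
    ((hasGaussianLaw_of_map_pi he).eval i).memLp_two
  have h0 : cov[u, e i; P] = 0 :=
    IndepFun.covariance_eq_zero (hind.comp (φ := fun q : ℝ × (Fin n → ℝ) => q.1)
      (ψ := fun e : Fin n → ℝ => e i) (by fun_prop) (by fun_prop)) hu (hE i)
  have h1 : cov[u, fun ω => V i ω + e i ω; P] = cov[u, V i + e i; P] := rfl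
  rw [h1, covariance_add_right hu (hV i) (hE i), h0, add_zero]

omit [IsProbabilityMeasure P] in
lemma noisy_integral (hG : HasGaussianLaw (fun ω => (u ω, fun i => V i ω)) P)
    (hV0 : ∀ i, ∫ ω, V i ω ∂P = 0) (hem : ∀ i, AEMeasurable (e i) P)
    (he : P.map (fun ω i => e i ω) = Measure.pi fun _ => gaussianReal 0 v) (i : Fin n) :
    ∫ ω, V i ω + e i ω ∂P = 0 := by
  have hE := ((hasGaussianLaw_of_map_pi he).eval i).integrable
  have h0 : ∫ ω, e i ω ∂P = 0 := by
    have := integral_map (f := fun x : ℝ => x) (hem i) (by fun_prop)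
    rw [map_eval_of_map_pi hem he, integral_id_gaussianReal] at this
    exact this.symm
  rw [integral_add (hG.snd.eval i).integrable hE, hV0, h0, add_zero]

/-- Given noisy observations of `V`, the error of the best linear prediction of `u` is independent
of the observations, and it is centred Gaussian with the Schur complement as variance. -/
lemma noisy_residual (hG : HasGaussianLaw (fun ω => (u ω, fun i => V i ω)) P)
    (hu0 : ∫ ω, u ω ∂P = 0) (hV0 : ∀ i, ∫ ω, V i ω ∂P = 0)
    (hem : ∀ i, AEMeasurable (e i) P) {σ : ℝ} (hσ : 0 < σ)
    (he : P.map (fun ω i => e i ω) = Measure.pi fun _ => gaussianReal 0 (σ ^ 2).toNNReal)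
    (hind : IndepFun (fun ω => (u ω, fun i => V i ω)) (fun ω i => e i ω) P) :
    let kz := fun i => cov[u, V i; P]
    IndepFun (fun ω => u ω - kz ⬝ᵥ ((noisyCov P σ V)⁻¹ *ᵥ fun i => V i ω + e i ω))
        (fun ω i => V i ω + e i ω) P ∧
      P.map (fun ω => u ω - kz ⬝ᵥ ((noisyCov P σ V)⁻¹ *ᵥ fun i => V i ω + e i ω)) =
        gaussianReal 0 (Var[u; P] - kz ⬝ᵥ ((noisyCov P σ V)⁻¹ *ᵥ kz)).toNNReal ∧
      0 ≤ Var[u; P] - kz ⬝ᵥ ((noisyCov P σ V)⁻¹ *ᵥ kz) := by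
  have hV : ∀ i, MemLp (V i) 2 P := fun i => (hG.snd.eval i).memLp_two
  have hM : IsUnit (noisyCov P σ V).det := (posDef_noisyCov hV hσ).det_pos.ne'.isUnit
  have hN := noisy_hasGaussianLaw hG he hind
  have hc := noisy_covariance hG hem he hind
  have hl := noisy_covariance_left hG he hind
  refine ⟨residual_indep hN hM hc hl,
    residual_law hN hu0 (noisy_integral hG hV0 hem he) hM hc hl, ?_⟩
  rw [← residual_variance hN hM hc hl]
  exact variance_nonneg _ _

end Noisy

end Regression

/-! ### The posterior given a fixed data vector -/

/-- The density at `y` of observations with mean `a` and independent `N(0, v)` noise. -/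
noncomputable def lik {n : ℕ} (v : NNReal) (a y : Fin n → ℝ) : ℝ≥0∞ :=
  ∏ i, gaussianPDF (a i) v (y i)

section Lik

variable {n : ℕ} {v : NNReal}

lemma lik_eq_ofReal (a y : Fin n → ℝ) :
    lik v a y = ENNReal.ofReal (∏ i, gaussianPDFReal (a i) v (y i)) := by
  rw [ENNReal.ofReal_prod_of_nonneg fun i _ => gaussianPDFReal_nonneg _ _ _]
  rfl

lemma continuous_gaussianPDFReal_uncurry :
    Continuous fun q : ℝ × ℝ => gaussianPDFReal q.1 v q.2 := by
  unfold gaussianPDFReal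
  fun_prop

lemma continuous_lik : Continuous fun q : (Fin n → ℝ) × (Fin n → ℝ) => lik v q.1 q.2 := by
  simp only [lik_eq_ofReal]
  refine ENNReal.continuous_ofReal.comp (continuous_finsetProd _ fun i _ => ?_)
  exact continuous_gaussianPDFReal_uncurry.comp (by fun_prop :
    Continuous fun q : (Fin n → ℝ) × (Fin n → ℝ) => (q.1 i, q.2 i))

lemma exists_lik_le (n : ℕ) (v : NNReal) :
    ∃ C : NNReal, ∀ a y : Fin n → ℝ, lik v a y ≤ C := by
  refine ⟨((√(2 * Real.pi * v))⁻¹ ^ n).toNNReal, fun a y => ?_⟩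
  rw [lik_eq_ofReal]
  refine ENNReal.ofReal_le_ofReal ?_
  calc ∏ i, gaussianPDFReal (a i) v (y i) ≤ ∏ _i : Fin n, (√(2 * Real.pi * v))⁻¹ := by
        refine Finset.prod_le_prod (fun i _ => gaussianPDFReal_nonneg _ _ _) fun i _ => ?_
        unfold gaussianPDFReal
        refine mul_le_of_le_one_right (by positivity) (Real.exp_le_one_iff.2 ?_)
        rw [neg_div]
        have : 0 ≤ (y i - a i) ^ 2 / (2 * (v : ℝ)) := by positivity
        linarith
    _ = _ := by simp

lemma measurable_lik {γ : Type*} [MeasurableSpace γ] {f g : γ → Fin n → ℝ} (hf : Measurable f)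
    (hg : Measurable g) : Measurable fun c => lik v (f c) (g c) := by
  unfold lik
  refine Finset.measurable_prod _ fun i _ => ?_
  exact measurable_uncurry_gaussianPDF.comp (((measurable_pi_apply i).comp hf).prodMk
    (measurable_const.prodMk ((measurable_pi_apply i).comp hg)))

/-- The density of observations at fixed points is the special case of `lintegral_obsOf` in which
the query rule visits the indices `0, …, n - 1` in order. -/
lemma lintegral_add_noise (hv : v ≠ 0) (a : Fin n → ℝ) {F : (Fin n → ℝ) → ℝ≥0∞}
    (hF : Measurable F) :
    ∫⁻ e, F (fun i => a i + e i) ∂(Measure.pi fun _ => gaussianReal 0 v) =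
      ∫⁻ y, F y * lik v a y := by
  set h : ℕ → ℝ := fun m => if hm : m < n then a ⟨m, hm⟩ else 0
  set p : (m : ℕ) → (Fin m → ℕ × ℝ) → ℕ := fun m _ => m
  have hp : ∀ m, Measurable (p m) := fun m => measurable_const
  have hist_fst : ∀ (m : ℕ) (y : Fin m → ℝ) (i : Fin m), (hist p m y i).1 = i := by
    intro m
    induction m with
    | zero => exact fun _ i => i.elim0
    | succ m ih =>
      intro y i
      refine Fin.lastCases ?_ (fun j => ?_) i
      · simp [hist, p]
      · simp [hist, ih]
  have hobs : ∀ (m : ℕ) (e : Fin m → ℝ), obsOf p h m e = fun i : Fin m => h i + e i := by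
    intro m
    induction m with
    | zero => exact fun _ => Subsingleton.elim _ _
    | succ m ih =>
      intro e
      ext i
      refine Fin.lastCases ?_ (fun j => ?_) i
      · simp [obsOf, p]
      · simp [obsOf, ih, Fin.init]
  have key := lintegral_obsOf hp (measurable_from_nat (f := h)) hv n hF
  have hh : ∀ i : Fin n, h i = a i := fun i => by simp [h]
  simp only [hobs, hist_fst, hh] at key
  exact key

end Lik

section Posterior

open Matrix

variable {W : Type*} [MeasurableSpace W] {ν : Measure W} [IsProbabilityMeasure ν] {n : ℕ}
  {u : W → ℝ} {V : Fin n → W → ℝ}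

lemma lintegral_noisy_prod {v : NNReal} (hv : v ≠ 0) (hV : ∀ i, Measurable (V i))
    {F : W × (Fin n → ℝ) → ℝ≥0∞} (hF : Measurable F) :
    ∫⁻ q, F (q.1, fun i => V i q.1 + q.2 i) ∂(ν.prod (Measure.pi fun _ => gaussianReal 0 v)) =
      ∫⁻ y, ∫⁻ w, F (w, y) * lik v (fun i => V i w) y ∂ν := by
  have hm : Measurable fun q : W × (Fin n → ℝ) => (q.1, fun i => V i q.1 + q.2 i) := by
    fun_prop
  have hl : Measurable fun q : W × (Fin n → ℝ) => lik v (fun i => V i q.1) q.2 :=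
    measurable_lik (by fun_prop) measurable_snd
  rw [lintegral_prod (fun q : W × (Fin n → ℝ) => F (q.1, fun i => V i q.1 + q.2 i))
    (hF.comp hm).aemeasurable,
    lintegral_lintegral_swap (f := fun y w => F (w, y) * lik v (fun i => V i w) y)]
  · refine lintegral_congr fun w => ?_
    exact lintegral_add_noise hv (fun i => V i w) (hF.comp measurable_prodMk_left)
  · exact ((hF.comp measurable_swap).mul (hl.comp measurable_swap)).aemeasurable

/-- Unnormalized posterior expectations of bounded continuous functions of the prediction error
depend continuously on the data. -/
lemma continuous_posterior_lintegral {v : NNReal} (hu : Measurable u)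
    (hV : ∀ i, Measurable (V i)) {l : (Fin n → ℝ) → ℝ} (hl : Continuous l)
    (Ψ : BoundedContinuousFunction ℝ NNReal) :
    Continuous fun y : Fin n → ℝ => ∫⁻ w, Ψ (u w - l y) * lik v (fun i => V i w) y ∂ν := by
  obtain ⟨C, hC⟩ := exists_lik_le n v
  have hmul : ∀ w y, (Ψ (u w - l y) : ℝ≥0∞) * lik v (fun i => V i w) y =
      ((Ψ (u w - l y) * (lik v (fun i => V i w) y).toNNReal : NNReal) : ℝ≥0∞) := by
    intro w y
    rw [ENNReal.coe_mul, ENNReal.coe_toNNReal ((hC _ _).trans_lt ENNReal.coe_lt_top).ne]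
  refine continuous_iff_continuousAt.2 fun y => ?_
  refine tendsto_lintegral_filter_of_dominated_convergence
    (fun _ => ((nndist 0 Ψ * C : NNReal) : ℝ≥0∞)) ?_ ?_ ?_ ?_
  · refine Filter.Eventually.of_forall fun y => ?_
    exact (Ψ.continuous.measurable.comp (hu.sub_const _)).coe_nnreal_ennreal.mul
      (measurable_lik (by fun_prop) measurable_const)
  · refine Filter.Eventually.of_forall fun y => Filter.Eventually.of_forall fun w => ?_
    rw [ENNReal.coe_mul]
    gcongr
    · exact Ψ.apply_le_nndist_zero _
    · exact hC _ _
  · simp [ENNReal.mul_ne_top]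
  · refine Filter.Eventually.of_forall fun w => ?_
    simp only [hmul]
    have hc : Continuous fun y : Fin n → ℝ =>
        Ψ (u w - l y) * (lik v (fun i => V i w) y).toNNReal := by
      refine (Ψ.continuous.comp (by fun_prop)).mul ?_
      refine continuous_iff_continuousAt.2 fun y => ?_
      refine (ENNReal.tendsto_toNNReal ((hC _ _).trans_lt ENNReal.coe_lt_top).ne).comp ?_
      exact (continuous_lik.comp (by fun_prop : Continuous fun y : Fin n → ℝ =>
        ((fun i => V i w), y))).tendsto y
    exact ENNReal.tendsto_coe.2 (hc.tendsto y)

/-- The prediction error of `u`, given noisy observations of `V` whose noise lives on an auxiliary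
factor. -/
lemma noisy_residual_prod (hum : Measurable u) (hVm : ∀ i, Measurable (V i))
    (hG : HasGaussianLaw (fun w => (u w, fun i => V i w)) ν)
    (hu0 : ∫ w, u w ∂ν = 0) (hV0 : ∀ i, ∫ w, V i w ∂ν = 0) {σ : ℝ} (hσ : 0 < σ) :
    let kz := fun i => cov[u, V i; ν]
    let Q := ν.prod (Measure.pi fun _ : Fin n => gaussianReal 0 (σ ^ 2).toNNReal)
    IndepFun (fun q : W × (Fin n → ℝ) => u q.1 - kz ⬝ᵥ ((noisyCov ν σ V)⁻¹ *ᵥ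
        fun i => V i q.1 + q.2 i)) (fun q i => V i q.1 + q.2 i) Q ∧
      Q.map (fun q : W × (Fin n → ℝ) => u q.1 - kz ⬝ᵥ ((noisyCov ν σ V)⁻¹ *ᵥ
        fun i => V i q.1 + q.2 i)) =
        gaussianReal 0 (Var[u; ν] - kz ⬝ᵥ ((noisyCov ν σ V)⁻¹ *ᵥ kz)).toNNReal ∧
      0 ≤ Var[u; ν] - kz ⬝ᵥ ((noisyCov ν σ V)⁻¹ *ᵥ kz) := by
  intro kz Q
  have hfst : MeasurePreserving Prod.fst Q ν := measurePreserving_fst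
  have hint : ∀ {a : W → ℝ}, Measurable a → ∫ q, a q.1 ∂Q = ∫ w, a w ∂ν := by
    intro a ha
    rw [← hfst.map_eq, integral_map measurable_fst.aemeasurable
      (by rw [hfst.map_eq]; exact ha.aestronglyMeasurable)]
  have hcovQ : ∀ {a b : W → ℝ}, Measurable a → Measurable b →
      cov[fun q => a q.1, fun q => b q.1; Q] = cov[a, b; ν] := by
    intro a b ha hb
    rw [← hfst.map_eq, covariance_map (by rw [hfst.map_eq]; exact ha.aestronglyMeasurable)
      (by rw [hfst.map_eq]; exact hb.aestronglyMeasurable) measurable_fst.aemeasurable]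
    rfl
  have hGQ : HasGaussianLaw (fun q : W × (Fin n → ℝ) => (u q.1, fun i => V i q.1)) Q := by
    constructor
    have := hG.isGaussian_map
    rw [show (fun q : W × (Fin n → ℝ) => (u q.1, fun i => V i q.1)) =
      (fun w => (u w, fun i => V i w)) ∘ Prod.fst from rfl, ← Measure.map_map (by fun_prop)
      measurable_fst, hfst.map_eq]
    exact this
  have hres := noisy_residual (P := Q) (u := fun q => u q.1) (V := fun i q => V i q.1)
    (e := fun i q => q.2 i) hGQ (by rw [← hu0, hint hum])
    (fun i => by rw [← hV0 i, hint (hVm i)]) (by fun_prop) hσ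
    (measurePreserving_snd (μ := ν)
      (ν := Measure.pi fun _ : Fin n => gaussianReal 0 (σ ^ 2).toNNReal)).map_eq
    (indepFun_prod (X := fun w => (u w, fun i => V i w)) (Y := fun e : Fin n → ℝ => e)
      (by fun_prop) measurable_id)
  have h1 : noisyCov Q σ (fun i q => V i q.1) = noisyCov ν σ V := by
    simp only [noisyCov, hcovQ (hVm _) (hVm _)]
  have h2 : (fun i => cov[fun q : W × (Fin n → ℝ) => u q.1, fun q => V i q.1; Q]) = kz :=
    funext fun i => hcovQ hum (hVm i)
  have h3 : Var[fun q : W × (Fin n → ℝ) => u q.1; Q] = Var[u; ν] := by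
    rw [← covariance_self (by fun_prop), ← covariance_self (by fun_prop), hcovQ hum hum]
  simp only [h1, h2, h3] at hres
  exact hres

/-- Bayes' rule at *every* data vector `y` (not merely almost every one, so that it may be used
for a design that depends on `y`): weighting the prior by the likelihood of `y` turns the
prediction error of `u` into a centred Gaussian with the posterior variance. The identity holds for
almost every `y` by independence of the prediction error and the observations, and both sides are
continuous in `y`. -/
theorem posterior_map (hum : Measurable u) (hVm : ∀ i, Measurable (V i))
    (hG : HasGaussianLaw (fun w => (u w, fun i => V i w)) ν)
    (hu0 : ∫ w, u w ∂ν = 0) (hV0 : ∀ i, ∫ w, V i w ∂ν = 0) {σ : ℝ} (hσ : 0 < σ)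
    (y : Fin n → ℝ) :
    let kz := fun i => cov[u, V i; ν]
    let v := (σ ^ 2).toNNReal
    (ν.withDensity fun w => lik v (fun i => V i w) y).map
        (fun w => u w - kz ⬝ᵥ ((noisyCov ν σ V)⁻¹ *ᵥ y)) =
      (∫⁻ w, lik v (fun i => V i w) y ∂ν) •
        gaussianReal 0 (Var[u; ν] - kz ⬝ᵥ ((noisyCov ν σ V)⁻¹ *ᵥ kz)).toNNReal := by
  intro kz v
  set s := (Var[u; ν] - kz ⬝ᵥ ((noisyCov ν σ V)⁻¹ *ᵥ kz)).toNNReal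
  set l : (Fin n → ℝ) → ℝ := fun y => kz ⬝ᵥ ((noisyCov ν σ V)⁻¹ *ᵥ y) with hldef
  have hl : Continuous l := by
    simp only [hldef, dotProduct_mulVec]
    simp only [dotProduct]
    fun_prop
  have hv : v ≠ 0 := by simp [v, hσ.ne']
  obtain ⟨C, hC⟩ := exists_lik_le n v
  have hlikm : ∀ y : Fin n → ℝ, Measurable fun w => lik v (fun i => V i w) y := fun y =>
    measurable_lik (by fun_prop) measurable_const
  set c : (Fin n → ℝ) → ℝ≥0∞ := fun y => ∫⁻ w, lik v (fun i => V i w) y ∂ν with hc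
  have hcfin : ∀ y, c y ≠ ∞ := fun y => by
    refine ((lintegral_mono fun w => hC _ _).trans_lt ?_).ne
    simp
  have : IsFiniteMeasure (ν.withDensity fun w => lik v (fun i => V i w) y) :=
    isFiniteMeasure_withDensity (hcfin y)
  refine ext_of_forall_lintegral_eq_of_IsFiniteMeasure fun Ψ => ?_
  have hΨm : Measurable fun t => (Ψ t : ℝ≥0∞) := Ψ.continuous.measurable.coe_nnreal_ennreal
  have hint : ∀ y, ∫⁻ w, Ψ (u w - l y) * lik v (fun i => V i w) y ∂ν =
      (∫⁻ t, Ψ t ∂(gaussianReal 0 s)) * c y := by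
    have hcont1 := continuous_posterior_lintegral (ν := ν) (v := v) hum hVm hl Ψ
    have hcont2 : Continuous fun y => (∫⁻ t, Ψ t ∂(gaussianReal 0 s)) * c y := by
      have h0 := continuous_posterior_lintegral (ν := ν) (v := v) hum hVm hl 1
      simp only [BoundedContinuousFunction.coe_one, Pi.one_apply, ENNReal.coe_one, one_mul] at h0
      exact ENNReal.continuous_const_mul (Ψ.lintegral_lt_top_of_nnreal _).ne |>.comp h0
    refine fun y => congrFun ((hcont1.ae_eq_iff_eq volume hcont2).1 ?_) y
    refine ae_eq_of_forall_setLIntegral_eq_of_sigmaFinite hcont1.measurable hcont2.measurable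
      fun B hB _ => ?_
    obtain ⟨hind, hlaw, -⟩ := noisy_residual_prod hum hVm hG hu0 hV0 hσ
    set Q := ν.prod (Measure.pi fun _ : Fin n => gaussianReal 0 v)
    have hYm : Measurable fun q : W × (Fin n → ℝ) => fun i => V i q.1 + q.2 i := by fun_prop
    have hlm := hl.measurable
    have hrm : Measurable fun q : W × (Fin n → ℝ) => u q.1 - l fun i => V i q.1 + q.2 i :=
      (hum.comp measurable_fst).sub (hlm.comp hYm)
    have hBm : Measurable (B.indicator (1 : (Fin n → ℝ) → ℝ≥0∞)) := measurable_one.indicator hB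
    have key1 := lintegral_noisy_prod (ν := ν) (v := v) hv hVm
      (F := fun q => B.indicator 1 q.2 * Ψ (u q.1 - l q.2))
      ((hBm.comp measurable_snd).mul (hΨm.comp
        ((hum.comp measurable_fst).sub (hlm.comp measurable_snd))))
    have key2 := lintegral_noisy_prod (ν := ν) (v := v) hv hVm
      (F := fun q => B.indicator 1 q.2) (hBm.comp measurable_snd)
    have key3 := lintegral_mul_eq_lintegral_mul_lintegral_of_indepFun''
      (hBm.comp hYm).aemeasurable (hΨm.comp hrm).aemeasurable
      (hind.symm.comp (φ := B.indicator (1 : (Fin n → ℝ) → ℝ≥0∞))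
        (ψ := fun t : ℝ => (Ψ t : ℝ≥0∞)) hBm hΨm)
    have key4 : ∫⁻ q, Ψ (u q.1 - l fun i => V i q.1 + q.2 i) ∂Q =
        ∫⁻ t, Ψ t ∂(gaussianReal 0 s) := by
      rw [← hlaw, lintegral_map hΨm hrm]
    have hset : ∀ g : (Fin n → ℝ) → ℝ≥0∞, ∫⁻ y in B, g y = ∫⁻ y, B.indicator 1 y * g y := by
      intro g
      rw [← lintegral_indicator hB]
      refine lintegral_congr fun y => ?_
      by_cases hy : y ∈ B <;> simp [hy]
    have hind_ne : ∀ y, B.indicator (1 : (Fin n → ℝ) → ℝ≥0∞) y ≠ ∞ := fun y => by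
      by_cases hy : y ∈ B <;> simp [hy]
    simp only [Function.comp_def] at key3
    rw [hset, hset]
    calc ∫⁻ y, B.indicator 1 y * ∫⁻ w, Ψ (u w - l y) * lik v (fun i => V i w) y ∂ν
        = ∫⁻ y, ∫⁻ w, B.indicator 1 y * Ψ (u w - l y) * lik v (fun i => V i w) y ∂ν := by
          refine lintegral_congr fun y => ?_
          rw [← lintegral_const_mul' _ _ (hind_ne y)]
          simp only [mul_assoc]
      _ = (∫⁻ t, Ψ t ∂(gaussianReal 0 s)) *
            ∫⁻ q, B.indicator 1 (fun i => V i q.1 + q.2 i) ∂Q := by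
          rw [← key1, ← key4, mul_comm]
          exact key3
      _ = ∫⁻ y, B.indicator 1 y * ((∫⁻ t, Ψ t ∂(gaussianReal 0 s)) * c y) := by
          rw [key2, ← lintegral_const_mul']
          · refine lintegral_congr fun y => ?_
            rw [lintegral_const_mul' _ _ (hind_ne y)]
            simp only [hc]
            ring
          · exact (Ψ.lintegral_lt_top_of_nnreal _).ne
  rw [lintegral_map (f := fun t => (Ψ t : ℝ≥0∞)) hΨm (hum.sub_const _),
    lintegral_withDensity_eq_lintegral_mul (g := fun w => (Ψ (u w - l y) : ℝ≥0∞)) _ (hlikm y)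
    (hΨm.comp (hum.sub_const _)), lintegral_smul_measure, smul_eq_mul, mul_comm]
  exact (hint y).trans (mul_comm _ _)

end Posterior

/-! ### Confidence bounds along an adaptive design -/

lemma gaussianReal_Ioi_zero_le (v : NNReal) :
    gaussianReal 0 v (Set.Ioi 0) ≤ ENNReal.ofReal (1 / 2) := by
  have h1 : gaussianReal 0 v (Set.Iio 0) = gaussianReal 0 v (Set.Ioi 0) := by
    have h := gaussianReal_map_neg (μ := 0) (v := v)
    rw [neg_zero] at h
    nth_rewrite 1 [← h]
    rw [Measure.map_apply measurable_neg measurableSet_Iio]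
    congr 1
    ext t
    simp
  have h2 : gaussianReal 0 v (Set.Iio 0) + gaussianReal 0 v (Set.Ioi 0) ≤ 1 := by
    have hd : Disjoint (Set.Iio (0 : ℝ)) (Set.Ioi 0) :=
      Set.disjoint_left.2 fun t ht ht' => lt_asymm (Set.mem_Iio.1 ht) (Set.mem_Ioi.1 ht')
    rw [← measure_union hd measurableSet_Ioi]
    exact prob_le_one
  rw [h1, ← two_mul] at h2
  rw [one_div, ENNReal.ofReal_inv_of_pos two_pos, ENNReal.ofReal_ofNat,
    ENNReal.le_inv_iff_mul_le, mul_comm]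
  exact h2

/-- The Gaussian tail bound with the factor `1/2`; shifting the density by `c √v` costs at most
`exp (-c²/2)` on the positive half-line. -/
lemma gaussianReal_tail (v : NNReal) {c : ℝ} (hc : 0 ≤ c) :
    gaussianReal 0 v {t | c * √v < t} ≤ ENNReal.ofReal (1 / 2 * Real.exp (-c ^ 2 / 2)) := by
  by_cases hv : v = 0
  · subst hv
    simp
  have hvp : (0 : ℝ) < v := by positivity
  have h1 : gaussianReal 0 v {t | c * √v < t} =
      gaussianReal (-(c * √v)) v (Set.Ioi 0) := by
    rw [show -(c * √v) = 0 - c * √v by ring, ← gaussianReal_map_sub_const,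
      Measure.map_apply (by fun_prop) measurableSet_Ioi]
    congr 1
    ext t
    simp
  have h2 : ∀ t ∈ Set.Ioi (0 : ℝ), gaussianPDF (-(c * √v)) v t ≤
      ENNReal.ofReal (Real.exp (-c ^ 2 / 2)) * gaussianPDF 0 v t := by
    intro t ht
    rw [gaussianPDF, gaussianPDF, ← ENNReal.ofReal_mul (Real.exp_pos _).le]
    refine ENNReal.ofReal_le_ofReal ?_
    rw [gaussianPDFReal, gaussianPDFReal, mul_left_comm, ← Real.exp_add]
    gcongr
    have hs : √(v : ℝ) ^ 2 = v := Real.sq_sqrt hvp.le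
    have : 0 ≤ c * √v * t / v := by
      have : 0 < t := ht
      positivity
    have e : -(t - -(c * √v)) ^ 2 / (2 * v) =
        -c ^ 2 / 2 + -(t - 0) ^ 2 / (2 * v) - c * √v * t / v := by
      field_simp
      ring_nf
      rw [hs]
    linarith
  rw [h1, gaussianReal_apply _ hv]
  calc ∫⁻ t in Set.Ioi 0, gaussianPDF (-(c * √v)) v t
      ≤ ∫⁻ t in Set.Ioi 0, ENNReal.ofReal (Real.exp (-c ^ 2 / 2)) * gaussianPDF 0 v t :=
        setLIntegral_mono ((measurable_gaussianPDF _ _).const_mul _) h2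
    _ = ENNReal.ofReal (Real.exp (-c ^ 2 / 2)) * gaussianReal 0 v (Set.Ioi 0) := by
        rw [lintegral_const_mul _ (measurable_gaussianPDF _ _), gaussianReal_apply _ hv]
    _ ≤ ENNReal.ofReal (Real.exp (-c ^ 2 / 2)) * ENNReal.ofReal (1 / 2) := by
        gcongr
        exact gaussianReal_Ioi_zero_le v
    _ = _ := by rw [← ENNReal.ofReal_mul (Real.exp_pos _).le, mul_comm]

lemma gaussianReal_tail_neg (v : NNReal) {c : ℝ} (hc : 0 ≤ c) :
    gaussianReal 0 v {t | c * √v < -t} ≤ ENNReal.ofReal (1 / 2 * Real.exp (-c ^ 2 / 2)) := by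
  refine le_trans (le_of_eq ?_) (gaussianReal_tail v hc)
  have h := gaussianReal_map_neg (μ := 0) (v := v)
  rw [neg_zero] at h
  nth_rewrite 2 [← h]
  rw [Measure.map_apply measurable_neg (measurableSet_lt (by fun_prop) (by fun_prop))]
  rfl

section Adaptive

open Matrix

/-- A jointly measurable centred Gaussian process `ev` on `D` with covariance `k`, continuous on
`D × D`. -/
structure IsGPEval {W : Type*} [MeasurableSpace W] {d : ℕ} {D : Set (Pt d)} (ν : Measure W)
    (ev : W → D → ℝ) (k : Pt d → Pt d → ℝ) : Prop where
  measurable : Measurable (Function.uncurry ev)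
  gaussian : IsGaussianProcess (fun z w => ev w z) ν
  mean_zero : ∀ z, ∫ w, ev w z ∂ν = 0
  cov_eq : ∀ z z' : D, cov[fun w => ev w z, fun w => ev w z'; ν] = k z z'
  continuous_kernel : Continuous fun q : D × D => k q.1 q.2

variable {W : Type*} [MeasurableSpace W] {ν : Measure W} {d : ℕ}
  {D : Set (Pt d)} {ev : W → D → ℝ} {k : Pt d → Pt d → ℝ}

lemma hasGaussianLaw_of_isGaussianProcess {T : Type*} {Y : T → W → ℝ}
    (hY : IsGaussianProcess Y ν) (z : T) {n : ℕ} (X : Fin n → T) :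
    HasGaussianLaw (fun w => (Y z w, fun i => Y (X i) w)) ν := by
  classical
  let I : Finset T := insert z (Finset.univ.image X)
  have hz : z ∈ I := by simp [I]
  have hX : ∀ i, X i ∈ I := fun i => by simp [I]
  let L : (I → ℝ) →L[ℝ] (ℝ × (Fin n → ℝ)) :=
    (ContinuousLinearMap.proj (R := ℝ) (φ := fun _ : I => ℝ) ⟨z, hz⟩).prod
      (ContinuousLinearMap.pi fun i => ContinuousLinearMap.proj (R := ℝ) (φ := fun _ : I => ℝ)
        ⟨X i, hX i⟩)
  exact (hY.hasGaussianLaw I).map_fun L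

namespace IsGPEval

variable (h : IsGPEval ν ev k)
include h

lemma measurable_eval (z : D) : Measurable fun w => ev w z :=
  h.measurable.comp measurable_prodMk_right

lemma noisyCov_eq {n : ℕ} (σ : ℝ) (X : Fin n → D) :
    noisyCov ν σ (fun i w => ev w (X i)) = noisyGram k σ fun i => (X i : Pt d) := by
  simp only [noisyCov, noisyGram, h.cov_eq]

lemma symm (z z' : D) : k z z' = k z' z := by
  rw [← h.cov_eq, ← h.cov_eq, covariance_comm]

lemma continuous_noisyGram (n : ℕ) (σ : ℝ) :
    Continuous fun X : Fin n → D => noisyGram k σ fun i => (X i : Pt d) := by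
  refine continuous_matrix fun i j => ?_
  simp only [noisyGram, Matrix.add_apply, Matrix.of_apply]
  refine Continuous.add ?_ continuous_const
  exact h.continuous_kernel.comp (by fun_prop : Continuous fun X : Fin n → D => (X i, X j))

lemma posDef_noisyGram {n : ℕ} {σ : ℝ} (hσ : 0 < σ) (X : Fin n → D) :
    (noisyGram k σ fun i => (X i : Pt d)).PosDef := by
  have := h.gaussian.isProbabilityMeasure
  rw [← h.noisyCov_eq]
  exact posDef_noisyCov (fun i => (h.gaussian.hasGaussianLaw_eval (X i)).memLp_two) hσ

lemma continuous_noisyGram_inv (n : ℕ) {σ : ℝ} (hσ : 0 < σ) :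
    Continuous fun X : Fin n → D => (noisyGram k σ fun i => (X i : Pt d))⁻¹ := by
  simp only [Matrix.inv_def, Ring.inverse_eq_inv']
  have hc := h.continuous_noisyGram n σ
  exact (hc.matrix_det.inv₀ fun X => (h.posDef_noisyGram hσ X).det_pos.ne').smul
    hc.matrix_adjugate

lemma continuous_postMean (n : ℕ) {σ : ℝ} (hσ : 0 < σ) :
    Continuous fun q : (Fin n → D) × (Fin n → ℝ) × D =>
      postMean k σ (fun i => (q.1 i : Pt d)) q.2.1 q.2.2 := by
  have hc := (h.continuous_noisyGram_inv n hσ).comp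
    (continuous_fst : Continuous fun q : (Fin n → D) × (Fin n → ℝ) × D => q.1)
  refine Continuous.dotProduct (continuous_pi fun i => ?_)
    (hc.matrix_mulVec (by fun_prop))
  exact h.continuous_kernel.comp (by fun_prop :
    Continuous fun q : (Fin n → D) × (Fin n → ℝ) × D => (q.2.2, q.1 i))

lemma continuous_postVar (n : ℕ) {σ : ℝ} (hσ : 0 < σ) :
    Continuous fun q : (Fin n → D) × D => postVar k σ (fun i => (q.1 i : Pt d)) q.2 := by
  have hc := (h.continuous_noisyGram_inv n hσ).comp
    (continuous_fst : Continuous fun q : (Fin n → D) × D => q.1)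
  refine Continuous.sub ?_ (Continuous.dotProduct (continuous_pi fun i => ?_)
    (hc.matrix_mulVec (continuous_pi fun i => ?_)))
  · exact h.continuous_kernel.comp (by fun_prop : Continuous fun q : (Fin n → D) × D => (q.2, q.2))
  · exact h.continuous_kernel.comp
      (by fun_prop : Continuous fun q : (Fin n → D) × D => (q.2, q.1 i))
  · exact h.continuous_kernel.comp
      (by fun_prop : Continuous fun q : (Fin n → D) × D => (q.1 i, q.2))

variable [IsProbabilityMeasure ν]

omit [IsProbabilityMeasure ν] in
lemma postVar_eq {n : ℕ} (σ : ℝ) (X : Fin n → D) (z : D) :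
    Var[fun w => ev w z; ν] - (fun i => cov[fun w => ev w z, fun w => ev w (X i); ν]) ⬝ᵥ
      ((noisyCov ν σ (fun i w => ev w (X i)))⁻¹ *ᵥ
        fun i => cov[fun w => ev w z, fun w => ev w (X i); ν]) =
    postVar k σ (fun i => (X i : Pt d)) z := by
  rw [← covariance_self (h.measurable_eval z).aemeasurable, h.noisyCov_eq]
  simp only [h.cov_eq, postVar, h.symm _ z]

lemma postVar_nonneg {n : ℕ} {σ : ℝ} (hσ : 0 < σ) (X : Fin n → D) (z : D) :
    0 ≤ postVar k σ (fun i => (X i : Pt d)) z := by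
  rw [← h.postVar_eq]
  exact (noisy_residual_prod (h.measurable_eval z) (fun i => h.measurable_eval (X i))
    (hasGaussianLaw_of_isGaussianProcess h.gaussian z X) (h.mean_zero z)
    (fun i => h.mean_zero _) hσ).2.2

/-- Given the data `y` at fixed points `X`, the posterior probability that the prediction error at
`z` lies in `B` is at most `c`, in the form multiplied out by the marginal likelihood of `y`. -/
lemma posterior_tail {n : ℕ} {σ : ℝ} (hσ : 0 < σ) (X : Fin n → D) (z : D) (y : Fin n → ℝ)
    {c : ℝ} {B : Set ℝ} (hB : MeasurableSet B)
    (hc : ∀ v : NNReal, √v = postSD k σ (fun i => (X i : Pt d)) z →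
      gaussianReal 0 v B ≤ ENNReal.ofReal c) :
    ∫⁻ w, B.indicator 1 (ev w z - postMean k σ (fun i => (X i : Pt d)) y z) *
        lik (σ ^ 2).toNNReal (fun i => ev w (X i)) y ∂ν ≤
      ENNReal.ofReal c * ∫⁻ w, lik (σ ^ 2).toNNReal (fun i => ev w (X i)) y ∂ν := by
  have hpm := posterior_map (h.measurable_eval z) (fun i => h.measurable_eval (X i))
    (hasGaussianLaw_of_isGaussianProcess h.gaussian z X) (h.mean_zero z)
    (fun i => h.mean_zero _) hσ y
  simp only [h.postVar_eq] at hpm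
  simp only [h.noisyCov_eq, h.cov_eq] at hpm
  have hpm' := congrArg (fun m : Measure ℝ => m B) hpm
  have hmm : Measurable fun w => ev w z - postMean k σ (fun i => (X i : Pt d)) y z :=
    (h.measurable_eval z).sub_const _
  simp only [Measure.smul_apply, smul_eq_mul] at hpm'
  change Measure.map (fun w => ev w z - postMean k σ (fun i => (X i : Pt d)) y z) _ B = _ at hpm'
  rw [Measure.map_apply hmm hB, withDensity_apply _ (hmm hB),
    ← lintegral_indicator (hmm hB)] at hpm'
  have hv := hc (postVar k σ (fun i => (X i : Pt d)) z).toNNReal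
    (by rw [Real.coe_toNNReal _ (h.postVar_nonneg hσ X z)]; rfl)
  calc _ = _ := lintegral_congr fun w => ?_
    _ = _ := hpm'
    _ ≤ _ := by rw [mul_comm]; gcongr
  by_cases hw : ev w z - postMean k σ (fun i => (X i : Pt d)) y z ∈ B
  · simp [hw, Set.indicator]
  · simp [hw, Set.indicator]

/-- Confidence bounds hold along an adaptive design: at a point `g y` chosen from the data `y`, the
standardized prediction error has the Gaussian tail. Once the data vector is fixed the design is
deterministic, so Bayes' rule for fixed designs applies under the integral over `y`. -/
lemma adaptive_tail {σ : ℝ} (hσ : 0 < σ) {p : (n : ℕ) → (Fin n → D × ℝ) → D}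
    (hp : ∀ n, Measurable (p n)) (n : ℕ) {g : (Fin n → ℝ) → D} (hg : Measurable g)
    {c : ℝ} {B : Set (ℝ × ℝ)} (hB : MeasurableSet B)
    (hc : ∀ v : NNReal, gaussianReal 0 v {t | (√v, t) ∈ B} ≤ ENNReal.ofReal c) :
    (ν.prod (Measure.pi fun _ : Fin n => gaussianReal 0 (σ ^ 2).toNNReal)) {q |
      (postSD k σ (fun i => ((hist p n (obsOf p (ev q.1) n q.2) i).1 : Pt d))
          (g (obsOf p (ev q.1) n q.2)),
        ev q.1 (g (obsOf p (ev q.1) n q.2)) -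
          postMean k σ (fun i => ((hist p n (obsOf p (ev q.1) n q.2) i).1 : Pt d))
            (obsOf p (ev q.1) n q.2) (g (obsOf p (ev q.1) n q.2))) ∈ B} ≤ ENNReal.ofReal c := by
  set v := (σ ^ 2).toNNReal
  have hv : v ≠ 0 := by simp [v, hσ.ne']
  set X : (Fin n → ℝ) → Fin n → D := fun y i => (hist p n y i).1
  have hX : Measurable X := measurable_pi_lambda _ fun i =>
    measurable_fst.comp ((measurable_pi_apply i).comp (measurable_hist hp n))
  set T : W × (Fin n → ℝ) → ℝ × ℝ := fun q => (postSD k σ (fun i => (X q.2 i : Pt d)) (g q.2),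
    ev q.1 (g q.2) - postMean k σ (fun i => (X q.2 i : Pt d)) q.2 (g q.2)) with hTdef
  have hev : Measurable fun q : W × (Fin n → ℝ) => ev q.1 (g q.2) :=
    h.measurable.comp (measurable_fst.prodMk (hg.comp measurable_snd))
  have hSDm : Measurable fun y => postSD k σ (fun i => (X y i : Pt d)) (g y) :=
    Real.continuous_sqrt.measurable.comp
      ((h.continuous_postVar n hσ).measurable.comp (hX.prodMk hg))
  have hMm : Measurable fun y => postMean k σ (fun i => (X y i : Pt d)) y (g y) :=
    (h.continuous_postMean n hσ).measurable.comp (hX.prodMk (measurable_id.prodMk hg))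
  have hT : Measurable T := (hSDm.comp measurable_snd).prodMk (hev.sub (hMm.comp measurable_snd))
  have hobs : Measurable fun q : W × (Fin n → ℝ) => (q.1, obsOf p (ev q.1) n q.2) :=
    measurable_fst.prodMk (measurable_obsOf_uncurry hp h.measurable n)
  have hlik : Measurable fun q : W × (Fin n → ℝ) => lik v (fun i => ev q.1 (X q.2 i)) q.2 := by
    refine measurable_lik (measurable_pi_lambda _ fun i => ?_) measurable_snd
    exact h.measurable.comp (measurable_fst.prodMk
      ((measurable_pi_apply i).comp (hX.comp measurable_snd)))
  have hTB : MeasurableSet (T ⁻¹' B) := hT hB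
  have hind : Measurable ((T ⁻¹' B).indicator (1 : W × (Fin n → ℝ) → ℝ≥0∞)) :=
    measurable_one.indicator hTB
  have hchange : ∀ F : W × (Fin n → ℝ) → ℝ≥0∞, Measurable F →
      ∫⁻ q, F (q.1, obsOf p (ev q.1) n q.2)
        ∂(ν.prod (Measure.pi fun _ : Fin n => gaussianReal 0 v)) =
      ∫⁻ y, ∫⁻ w, F (w, y) * lik v (fun i => ev w (X y i)) y ∂ν := by
    intro F hF
    rw [lintegral_prod (fun q : W × (Fin n → ℝ) => F (q.1, obsOf p (ev q.1) n q.2))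
      (hF.comp hobs).aemeasurable,
      lintegral_lintegral_swap (f := fun y w => F (w, y) * lik v (fun i => ev w (X y i)) y)]
    · refine lintegral_congr fun w => ?_
      exact lintegral_obsOf hp (h.measurable.comp measurable_prodMk_left) hv n
        (hF.comp measurable_prodMk_left)
    · exact ((hF.comp measurable_swap).mul (hlik.comp measurable_swap)).aemeasurable
  have hone : ∫⁻ y, ∫⁻ w, lik v (fun i => ev w (X y i)) y ∂ν = 1 := by
    have := hchange (fun _ => 1) measurable_const
    simpa using this.symm
  change (ν.prod (Measure.pi fun _ : Fin n => gaussianReal 0 v))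
    ((fun q : W × (Fin n → ℝ) => (q.1, obsOf p (ev q.1) n q.2)) ⁻¹' (T ⁻¹' B)) ≤ _
  rw [← lintegral_indicator_one (hobs hTB)]
  calc _ = ∫⁻ y, ∫⁻ w, (T ⁻¹' B).indicator 1 (w, y) * lik v (fun i => ev w (X y i)) y ∂ν :=
        hchange _ hind
    _ ≤ ∫⁻ y, ENNReal.ofReal c * ∫⁻ w, lik v (fun i => ev w (X y i)) y ∂ν := by
        refine lintegral_mono fun y => ?_
        refine le_trans (le_of_eq (lintegral_congr fun w => ?_)) (h.posterior_tail hσ (X y) (g y) y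
          (B := {t | (postSD k σ (fun i => (X y i : Pt d)) (g y), t) ∈ B})
          (measurable_prodMk_left hB) fun v hv => by rw [← hv]; exact hc v)
        rfl
    _ = _ := by
        rw [lintegral_const_mul' _ _ ENNReal.ofReal_ne_top, hone, mul_one]

end IsGPEval

end Adaptive

/-! ### The prior as a law on path space -/

section PathSpace

variable {Ω : Type*} [MeasurableSpace Ω] {P : Measure Ω} [IsProbabilityMeasure P] {d : ℕ}
  {f : Pt d → Ω → ℝ} {ε : ℕ → Ω → ℝ} {D : Set (Pt d)} {k : Pt d → Pt d → ℝ} {σ : ℝ}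

lemma integral_cos_of_gaussian {Y : Ω → ℝ} (hY : HasGaussianLaw Y P) (h0 : ∫ ω, Y ω ∂P = 0) :
    ∫ ω, Real.cos (Y ω) ∂P = Real.exp (-Var[Y; P] / 2) := by
  have h1 : charFun (P.map Y) 1 = ((Real.exp (-Var[Y; P] / 2) : ℝ) : ℂ) := by
    rw [hY.map_eq_gaussianReal, charFun_gaussianReal, h0]
    simp [Real.coe_toNNReal _ (variance_nonneg Y P), neg_div]
  have hint : Integrable (fun ω => Complex.exp (Y ω * Complex.I)) P := by
    refine Integrable.of_bound (C := 1) ?_ (Filter.Eventually.of_forall fun ω => ?_)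
    · have := hY.aemeasurable
      fun_prop
    · rw [Complex.norm_exp_ofReal_mul_I]
  rw [charFun_apply_real, integral_map hY.aemeasurable (by fun_prop)] at h1
  have h2 := congrArg Complex.re h1
  simp only [Complex.ofReal_one, one_mul, Complex.ofReal_re] at h2
  rw [← h2, ← RCLike.re_eq_complex_re, ← integral_re hint]
  refine integral_congr_ae (Filter.Eventually.of_forall fun ω => ?_)
  simp [Complex.exp_ofReal_mul_I_re]

/-- A Gaussian process with continuous paths has a continuous covariance kernel: the variance of
`f z + f z'` can be read off from `E cos (f z + f z')`, which is continuous by dominated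
convergence. -/
lemma continuous_kernel (hM : IsGPModel P f ε D k σ)
    (hcont : ∀ᵐ ω ∂P, ContinuousOn (fun z => f z ω) D) :
    Continuous fun q : D × D => k q.1 q.2 := by
  have hL2 : ∀ z : D, MemLp (f z) 2 P := fun z => (hM.gaussian.hasGaussianLaw_eval z).memLp_two
  have hV : Continuous fun q : D × D => Var[fun ω => f q.1 ω + f q.2 ω; P] := by
    have hexp : ∀ q : D × D, ∫ ω, Real.cos (f q.1 ω + f q.2 ω) ∂P =
        Real.exp (-Var[fun ω => f q.1 ω + f q.2 ω; P] / 2) := by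
      intro q
      refine integral_cos_of_gaussian hM.gaussian.hasGaussianLaw_fun_add ?_
      rw [integral_add ((hL2 _).integrable (by norm_num)) ((hL2 _).integrable (by norm_num)),
        hM.mean_zero _ q.1.2, hM.mean_zero _ q.2.2, add_zero]
    have hc : Continuous fun q : D × D => ∫ ω, Real.cos (f q.1 ω + f q.2 ω) ∂P := by
      refine continuous_of_dominated (bound := fun _ => 1) (fun q => ?_) (fun q => ?_)
        (integrable_const _) ?_
      · exact (Real.continuous_cos.measurable.comp ((hM.measurable_f _ q.1.2).add
          (hM.measurable_f _ q.2.2))).aestronglyMeasurable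
      · exact Filter.Eventually.of_forall fun ω => Real.abs_cos_le_one _
      · filter_upwards [hcont] with ω hω
        have := continuousOn_iff_continuous_domRestrict.1 hω
        exact Real.continuous_cos.comp ((this.comp continuous_fst).add (this.comp continuous_snd))
    have hl : Continuous fun q : D × D => -2 * Real.log (∫ ω, Real.cos (f q.1 ω + f q.2 ω) ∂P) :=
      continuous_const.mul (hc.log fun q => by rw [hexp]; exact (Real.exp_pos _).ne')
    simp only [hexp, Real.log_exp] at hl
    convert hl using 2
    ring
  have hk : ∀ q : D × D, k q.1 q.2 = (Var[fun ω => f q.1 ω + f q.2 ω; P] -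
      Var[fun ω => f q.1 ω + f q.1 ω; P] / 4 - Var[fun ω => f q.2 ω + f q.2 ω; P] / 4) / 2 := by
    intro q
    have h1 : ∀ z z' : D, Var[fun ω => f z ω + f z' ω; P] = k z z + 2 * k z z' + k z' z' := by
      intro z z'
      rw [variance_fun_add (hL2 z) (hL2 z'),
        ← covariance_self (hM.measurable_f _ z.2).aemeasurable,
        ← covariance_self (hM.measurable_f _ z'.2).aemeasurable,
        hM.covariance_eq _ z.2 _ z.2, hM.covariance_eq _ z.2 _ z'.2, hM.covariance_eq _ z'.2 _ z'.2]
    rw [h1, h1, h1]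
    ring
  simp only [hk]
  exact ((hV.sub ((hV.comp (continuous_fst.prodMk continuous_fst)).div_const 4)).sub
    ((hV.comp (continuous_snd.prodMk continuous_snd)).div_const 4)).div_const 2

/-- The evaluation of a path at a point, through its values at a countable dense set of points; it
is jointly measurable in the path and the point, and for a continuous path it is the honest
evaluation. -/
noncomputable def evalPath [Nonempty D] (w : D → ℝ) (z : D) : ℝ :=
  Filter.limsup (fun m => w (SimpleFunc.nearestPt (TopologicalSpace.denseSeq D) m z)) Filter.atTop

lemma measurable_evalPath [Nonempty D] :
    Measurable (Function.uncurry (evalPath : (D → ℝ) → D → ℝ)) := by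
  refine Measurable.limsup fun m => ?_
  have h1 : Measurable fun q : (D → ℝ) × ℕ => q.1 (TopologicalSpace.denseSeq D q.2) :=
    measurable_from_prod_countable_left fun i => (measurable_pi_apply
      (TopologicalSpace.denseSeq D i) : Measurable fun w : D → ℝ => w _)
  exact h1.comp (measurable_fst.prodMk
    ((SimpleFunc.nearestPtInd (TopologicalSpace.denseSeq D) m).measurable.comp measurable_snd))

lemma evalPath_eq [Nonempty D] {w : D → ℝ} (hw : Continuous w) (z : D) : evalPath w z = w z := by
  refine Filter.Tendsto.limsup_eq ((hw.tendsto z).comp ?_)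
  exact SimpleFunc.tendsto_nearestPt (by
    rw [(TopologicalSpace.denseRange_denseSeq D).closure_range]; trivial)

attribute [irreducible] evalPath

omit [IsProbabilityMeasure P] in
lemma measurable_path (hM : IsGPModel P f ε D k σ) : Measurable fun ω (x : D) => f x ω :=
  measurable_pi_lambda _ fun x => hM.measurable_f x x.2

omit [IsProbabilityMeasure P] in
lemma ae_evalPath [Nonempty D] (hcont : ∀ᵐ ω ∂P, ContinuousOn (fun z => f z ω) D) :
    ∀ᵐ ω ∂P, ∀ z : D, evalPath (fun x : D => f x ω) z = f z ω := by
  filter_upwards [hcont] with ω hω z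
  exact evalPath_eq (continuousOn_iff_continuous_domRestrict.1 hω) z

lemma isGPEval_path [Nonempty D] (hM : IsGPModel P f ε D k σ)
    (hcont : ∀ᵐ ω ∂P, ContinuousOn (fun z => f z ω) D) :
    IsGPEval (P.map fun ω (x : D) => f x ω) evalPath k := by
  have hpm := measurable_path hM
  have hae : ∀ z : D, (fun ω => evalPath (fun x : D => f x ω) z) =ᵐ[P] f z := fun z => by
    filter_upwards [ae_evalPath hcont] with ω hω using hω z
  have hme : ∀ z : D, Measurable fun w : D → ℝ => evalPath w z := fun z =>
    measurable_evalPath.comp measurable_prodMk_right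
  refine ⟨measurable_evalPath, ⟨fun I => ⟨?_⟩⟩, fun z => ?_, fun z z' => ?_,
    continuous_kernel hM hcont⟩
  · have h1 : IsGaussianProcess (fun (z : D) ω => evalPath (fun x : D => f x ω) z) P :=
      hM.gaussian.congr fun z => (hae z).symm
    have h2 := (h1.hasGaussianLaw I).isGaussian_map
    rw [Measure.map_map (by fun_prop) hpm]
    exact h2
  · rw [integral_map hpm.aemeasurable (hme z).aestronglyMeasurable,
      integral_congr_ae (hae z), hM.mean_zero z z.2]
  · rw [covariance_map (hme z).aestronglyMeasurable (hme z').aestronglyMeasurable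
      hpm.aemeasurable, ← hM.covariance_eq z z.2 z' z'.2, covariance, covariance]
    simp only [Function.comp_def]
    rw [integral_congr_ae (hae z), integral_congr_ae (hae z')]
    refine integral_congr_ae ?_
    filter_upwards [hae z, hae z'] with ω h1 h2
    rw [h1, h2]

lemma map_path_noise (hM : IsGPModel P f ε D k σ) (n : ℕ) :
    P.map (fun ω => ((fun (x : D) => f x ω), fun i : Fin n => ε i ω)) =
      (P.map fun ω (x : D) => f x ω).prod
        (Measure.pi fun _ : Fin n => gaussianReal 0 (σ ^ 2).toNNReal) := by
  have hε : Measurable fun ω (i : Fin n) => ε i ω :=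
    measurable_pi_lambda _ fun i => hM.measurable_noise i
  have hind : IndepFun (fun ω (x : D) => f x ω) (fun ω (i : Fin n) => ε i ω) P :=
    hM.indep.comp (φ := id) (ψ := fun e : ℕ → ℝ => fun i : Fin n => e i) measurable_id
      (by fun_prop)
  rw [hind.map_prod_eq_prod_map_map (measurable_path hM).aemeasurable hε.aemeasurable]
  congr 1
  have hi : iIndepFun (fun (i : Fin n) => ε i) P := hM.noise_indep.precomp Fin.val_injective
  have h := iIndepFun.map_fun_eq_pi_map (f := fun i : Fin n => ε i)
    (fun i => (hM.measurable_noise i).aemeasurable) hi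
  simp only [hM.noise_law] at h
  exact h

/-- A query rule with values in `D`, agreeing with `pol` whenever the latter queries a point of
`D`. -/
noncomputable def clampPol (pol : (n : ℕ) → (Fin n → Pt d × ℝ) → Pt d) (z₀ : D) (n : ℕ)
    (h : Fin n → D × ℝ) : D :=
  open Classical in
  if hmem : pol n (fun i => ((h i).1, (h i).2)) ∈ D then ⟨_, hmem⟩ else z₀

lemma measurable_clampPol {pol : (n : ℕ) → (Fin n → Pt d × ℝ) → Pt d}
    (hpol : ∀ n, Measurable (pol n)) (hD : MeasurableSet D) (z₀ : D) (n : ℕ) :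
    Measurable (clampPol pol z₀ n) := by
  classical
  have hq : Measurable fun h : Fin n → D × ℝ => pol n (fun i => (((h i).1 : Pt d), (h i).2)) :=
    (hpol n).comp (by fun_prop)
  have h1 : Measurable fun h : Fin n → D × ℝ =>
      if pol n (fun i => (((h i).1 : Pt d), (h i).2)) ∈ D then
        pol n (fun i => (((h i).1 : Pt d), (h i).2)) else (z₀ : Pt d) :=
    Measurable.ite (hq hD) hq measurable_const
  refine (MeasurableEmbedding.subtype_coe hD).measurable_comp_iff.1 ?_
  convert h1 using 1
  ext1 h
  simp only [Function.comp_apply, clampPol]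
  split_ifs <;> rfl

variable {β : ℕ → ℝ} {pol : (n : ℕ) → (Fin n → Pt d × ℝ) → Pt d} {x : ℕ → Ω → Pt d}
  {y : ℕ → Ω → ℝ}

omit [MeasurableSpace Ω] in
lemma clampPol_run (hR : IsRun f ε D k σ β pol x y) (z₀ : D) (n : ℕ) (ω : Ω) :
    clampPol pol z₀ n (fun i => (⟨x i ω, hR.mem i ω⟩, y i ω)) = ⟨x n ω, hR.mem n ω⟩ := by
  have h : pol n (fun i : Fin n => (x i ω, y i ω)) = x n ω := (hR.query n ω).symm
  simp only [clampPol, h, hR.mem n ω, dif_pos]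

omit [MeasurableSpace Ω] in
lemma hist_run (hR : IsRun f ε D k σ β pol x y) (z₀ : D) (n : ℕ) (ω : Ω) :
    hist (clampPol pol z₀) n (fun i => y i ω) =
      fun i : Fin n => (⟨x i ω, hR.mem i ω⟩, y i ω) := by
  induction n with
  | zero => exact Subsingleton.elim _ _
  | succ n ih =>
    have hinit : (Fin.init fun i : Fin (n + 1) => y i ω) = fun i : Fin n => y i ω := rfl
    simp only [hist, hinit, ih, clampPol_run hR]
    ext i : 1
    refine Fin.lastCases ?_ (fun j => ?_) i
    · simp
    · simp

omit [MeasurableSpace Ω] in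
lemma obsOf_run (hR : IsRun f ε D k σ β pol x y) (z₀ : D) {w : D → ℝ} {ω : Ω}
    (hw : ∀ z : D, w z = f z ω) (n : ℕ) :
    obsOf (clampPol pol z₀) w n (fun i => ε i ω) = fun i : Fin n => y i ω := by
  induction n with
  | zero => exact Subsingleton.elim _ _
  | succ n ih =>
    have hinit : (Fin.init fun i : Fin (n + 1) => ε i ω) = fun i : Fin n => ε i ω := rfl
    simp only [obsOf, hinit, ih, hist_run hR, clampPol_run hR, hw]
    ext i
    refine Fin.lastCases ?_ (fun j => ?_) i
    · simp [hR.observe]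
    · simp

/-- Gaussian tail of the standardized prediction error in round `n + 1` of a run, at a point chosen
measurably from the data of the first `n` rounds. -/
theorem run_tail (hM : IsGPModel P f ε D k σ) (hcont : ∀ᵐ ω ∂P, ContinuousOn (fun z => f z ω) D)
    (hR : IsRun f ε D k σ β pol x y) (hD : MeasurableSet D) (hσ : 0 < σ) (n : ℕ)
    {g : (Fin n → ℝ) → D} (hg : Measurable g) {c : ℝ} {B : Set (ℝ × ℝ)} (hB : MeasurableSet B)
    (hc : ∀ v : NNReal, gaussianReal 0 v {t | (√v, t) ∈ B} ≤ ENNReal.ofReal c) :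
    P {ω | (postSD k σ (fun i : Fin n => x i ω) (g fun i => y i ω),
      f (g fun i => y i ω) ω -
        postMean k σ (fun i : Fin n => x i ω) (fun i => y i ω) (g fun i => y i ω)) ∈ B} ≤
      ENNReal.ofReal c := by
  obtain ⟨ω₀⟩ : Nonempty Ω := nonempty_of_isProbabilityMeasure P
  set z₀ : D := ⟨x 0 ω₀, hR.mem 0 ω₀⟩
  have : Nonempty D := ⟨z₀⟩
  have hev := isGPEval_path hM hcont
  have : IsProbabilityMeasure (P.map fun ω (x : D) => f x ω) :=
    Measure.isProbabilityMeasure_map (measurable_path hM).aemeasurable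
  have ht := hev.adaptive_tail hσ (measurable_clampPol hR.measurable_pol hD z₀) n hg hB hc
  rw [← map_path_noise hM n] at ht
  refine le_trans ?_ (le_trans (Measure.le_map_apply ?_ _) ht)
  · refine measure_mono_ae ?_
    filter_upwards [ae_evalPath hcont] with ω hω hmem
    have h1 := obsOf_run hR z₀ hω n
    change (_, _) ∈ B
    simp only [h1, hist_run hR, hω]
    exact hmem
  · exact ((measurable_path hM).prodMk
      (measurable_pi_lambda _ fun i : Fin n => hM.measurable_noise i)).aemeasurable

/-- Upper confidence bound at a fixed point. -/
lemma run_upper (hM : IsGPModel P f ε D k σ) (hcont : ∀ᵐ ω ∂P, ContinuousOn (fun z => f z ω) D)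
    (hR : IsRun f ε D k σ β pol x y) (hD : MeasurableSet D) (hσ : 0 < σ) (n : ℕ) {z : Pt d}
    (hz : z ∈ D) {c : ℝ} (hc : 0 ≤ c) :
    P {ω | postMean k σ (fun i : Fin n => x i ω) (fun i => y i ω) z +
        c * postSD k σ (fun i : Fin n => x i ω) z < f z ω} ≤
      ENNReal.ofReal (1 / 2 * Real.exp (-c ^ 2 / 2)) := by
  refine le_trans (measure_mono fun ω hω => ?_) (run_tail hM hcont hR hD hσ n
    (g := fun _ => ⟨z, hz⟩) measurable_const (B := {q | c * q.1 < q.2})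
    (measurableSet_lt (by fun_prop) (by fun_prop)) fun v => gaussianReal_tail v hc)
  simp only [Set.mem_ofPred_eq] at hω ⊢
  linarith

/-- Lower confidence bound at the query point. -/
lemma run_lower (hM : IsGPModel P f ε D k σ) (hcont : ∀ᵐ ω ∂P, ContinuousOn (fun z => f z ω) D)
    (hR : IsRun f ε D k σ β pol x y) (hD : MeasurableSet D) (hσ : 0 < σ) (n : ℕ)
    {c : ℝ} (hc : 0 ≤ c) :
    P {ω | f (x n ω) ω < postMean k σ (fun i : Fin n => x i ω) (fun i => y i ω) (x n ω) -
        c * postSD k σ (fun i : Fin n => x i ω) (x n ω)} ≤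
      ENNReal.ofReal (1 / 2 * Real.exp (-c ^ 2 / 2)) := by
  obtain ⟨ω₀⟩ : Nonempty Ω := nonempty_of_isProbabilityMeasure P
  set z₀ : D := ⟨x 0 ω₀, hR.mem 0 ω₀⟩
  have hp := measurable_clampPol hR.measurable_pol hD z₀
  refine le_trans (measure_mono fun ω hω => ?_) (run_tail hM hcont hR hD hσ n
    (g := fun y => clampPol pol z₀ n (hist (clampPol pol z₀) n y))
    ((hp n).comp (measurable_hist hp n)) (B := {q | c * q.1 < -q.2})
    (measurableSet_lt (by fun_prop) (by fun_prop)) fun v => gaussianReal_tail_neg v hc)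
  simp only [Set.mem_ofPred_eq, hist_run hR, clampPol_run hR] at hω ⊢
  linarith

end PathSpace

/-! ### The mutual information of a Gaussian vector and its noisy observation -/

section MutualInfo

open Matrix

variable {Ω : Type*} [MeasurableSpace Ω] {P : Measure Ω} [IsProbabilityMeasure P] {n : ℕ}
  {V Y e : Fin n → Ω → ℝ}

/-- A whitening matrix of a positive definite matrix. -/
lemma exists_whitening {M : Matrix (Fin n) (Fin n) ℝ} (hM : M.PosDef) :
    ∃ B : Matrix (Fin n) (Fin n) ℝ, B.det ≠ 0 ∧ B * M * Bᵀ = 1 ∧ B.det ^ 2 = M.det⁻¹ := by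
  open scoped MatrixOrder in
  obtain ⟨A, hA⟩ := CStarAlgebra.nonneg_iff_eq_star_mul_self.1 hM.posSemidef.nonneg
  rw [star_eq_conjTranspose, conjTranspose_eq_transpose_of_trivial] at hA
  have hd : A.det ≠ 0 := by
    intro h0
    have := hM.det_pos
    rw [hA, det_mul, h0, mul_zero] at this
    exact lt_irrefl _ this
  have hAu : IsUnit A.det := hd.isUnit
  refine ⟨(A⁻¹)ᵀ, ?_, ?_, ?_⟩
  · rw [det_transpose, det_nonsing_inv, Ring.inverse_eq_inv']
    exact inv_ne_zero hd
  · rw [transpose_transpose, hA, ← mul_assoc, ← transpose_mul, mul_nonsing_inv _ hAu,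
      transpose_one, one_mul, mul_nonsing_inv _ hAu]
  · rw [det_transpose, det_nonsing_inv, Ring.inverse_eq_inv', hA, det_mul, det_transpose,
      inv_pow, sq]

/-- Whitened coordinates of a centred Gaussian vector are independent standard normal. -/
lemma map_whitening (hG : HasGaussianLaw (fun ω i => Y i ω) P) (hY0 : ∀ i, ∫ ω, Y i ω ∂P = 0)
    {M B : Matrix (Fin n) (Fin n) ℝ} (hcov : ∀ i j, cov[Y i, Y j; P] = M i j)
    (hB : B * M * Bᵀ = 1) :
    P.map (fun ω => B *ᵥ fun i => Y i ω) = Measure.pi fun _ => gaussianReal 0 1 := by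
  have hL2 : ∀ i, MemLp (Y i) 2 P := fun i => (hG.eval i).memLp_two
  have hGz : HasGaussianLaw (fun ω => B *ᵥ fun i => Y i ω) P :=
    hG.map_fun (LinearMap.toContinuousLinearMap (Matrix.toLin' B))
  set z : Fin n → Ω → ℝ := fun i ω => (B *ᵥ fun i => Y i ω) i
  have hz : ∀ i, z i = fun ω => ∑ j, B i j * Y j ω := fun i => rfl
  have hcz : ∀ i j, cov[z i, z j; P] = (1 : Matrix (Fin n) (Fin n) ℝ) i j := by
    intro i j
    rw [hz, hz, covariance_fun_sum_fun_sum (fun i => (hL2 i).const_mul _)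
      fun i => (hL2 i).const_mul _, ← hB]
    simp only [covariance_const_mul_left, covariance_const_mul_right, hcov, Matrix.mul_apply,
      Matrix.transpose_apply, Finset.sum_mul]
    rw [Finset.sum_comm]
    refine Finset.sum_congr rfl fun a _ => Finset.sum_congr rfl fun b _ => ?_
    ring
  have hind : iIndepFun z P := hGz.iIndepFun_of_covariance_eq_zero (X := z) fun i j hij => by
    rw [hcz, Matrix.one_apply_ne hij]
  have hmap := iIndepFun.map_fun_eq_pi_map (fun i => (hGz.eval (X := z) i).aemeasurable) hind
  have hone : ∀ i, P.map (z i) = gaussianReal 0 1 := by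
    intro i
    have hzi := hGz.eval (X := z) i
    rw [hzi.map_eq_gaussianReal, ← covariance_self hzi.aemeasurable, hcz, Matrix.one_apply_eq,
      Real.toNNReal_one, hz, integral_finsetSum _ fun j _ =>
        ((hL2 j).integrable (by norm_num)).const_mul _]
    simp [integral_const_mul, hY0]
  simp only [hone] at hmap
  exact hmap

/-- The density of a centred Gaussian vector, in terms of a whitening matrix of its covariance. -/
lemma map_eq_withDensity_whitening (hYm : ∀ i, Measurable (Y i))
    (hG : HasGaussianLaw (fun ω i => Y i ω) P) (hY0 : ∀ i, ∫ ω, Y i ω ∂P = 0)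
    {M B : Matrix (Fin n) (Fin n) ℝ} (hcov : ∀ i j, cov[Y i, Y j; P] = M i j)
    (hB : B * M * Bᵀ = 1) (hdet : B.det ≠ 0) :
    P.map (fun ω i => Y i ω) =
      volume.withDensity fun y => ENNReal.ofReal |B.det| * lik 1 0 (B *ᵥ y) := by
  have hmul : Measurable fun y : Fin n → ℝ => B *ᵥ y := by fun_prop
  have hmul' : Measurable fun y : Fin n → ℝ => B⁻¹ *ᵥ y := by fun_prop
  have hlik : Measurable fun y : Fin n → ℝ => lik 1 0 (B *ᵥ y) :=
    measurable_lik measurable_const hmul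
  have hYv : Measurable fun ω i => Y i ω := measurable_pi_lambda _ hYm
  have hinv : ∀ y, B⁻¹ *ᵥ (B *ᵥ y) = y := fun y => by
    rw [mulVec_mulVec, nonsing_inv_mul _ hdet.isUnit, one_mulVec]
  refine Measure.ext_of_lintegral _ fun F hF => ?_
  have hvol := Real.map_matrix_volume_pi_eq_smul_volume_pi hdet
  have h1 : ∫⁻ y, F y ∂(P.map fun ω i => Y i ω) =
      ∫⁻ z, F (B⁻¹ *ᵥ z) * lik 1 0 z := by
    have := lintegral_add_noise (v := 1) one_ne_zero (0 : Fin n → ℝ) (hF.comp hmul')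
    simp only [Pi.zero_apply, zero_add, Function.comp_apply] at this
    have hz : Measurable fun ω => B *ᵥ fun i => Y i ω := hmul.comp hYv
    have hmap := lintegral_map (μ := P) (hF.comp hmul') hz
    rw [map_whitening hG hY0 hcov hB] at hmap
    simp only [Function.comp_apply, hinv] at hmap
    rw [lintegral_map hF hYv, ← hmap, ← this]
  have h2 : ∫⁻ y, F (B⁻¹ *ᵥ (B *ᵥ y)) * lik 1 0 (B *ᵥ y) =
      ENNReal.ofReal |B.det⁻¹| * ∫⁻ z, F (B⁻¹ *ᵥ z) * lik 1 0 z := by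
    rw [← smul_eq_mul, ← lintegral_smul_measure, ← hvol, lintegral_map]
    · rfl
    · exact (hF.comp hmul').mul (measurable_lik measurable_const measurable_id)
    · exact hmul
  have hc : ENNReal.ofReal |B.det| * ENNReal.ofReal |B.det⁻¹| = 1 := by
    rw [← ENNReal.ofReal_mul (abs_nonneg _), ← abs_mul, mul_inv_cancel₀ hdet, abs_one,
      ENNReal.ofReal_one]
  rw [h1, lintegral_withDensity_eq_lintegral_mul _ (hlik.const_mul _) hF]
  simp only [hinv] at h2
  calc _ = ENNReal.ofReal |B.det| * (ENNReal.ofReal |B.det⁻¹| *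
        ∫⁻ z, F (B⁻¹ *ᵥ z) * lik 1 0 z) := by rw [← mul_assoc, hc, one_mul]
    _ = _ := by
        rw [← h2, ← lintegral_const_mul' _ _ ENNReal.ofReal_ne_top]
        refine lintegral_congr fun y => ?_
        simp only [Pi.mul_apply]
        ring

/-- The joint law of the observations and the signal. -/
lemma map_joint_eq_withDensity (hVm : ∀ i, Measurable (V i)) (hem : ∀ i, Measurable (e i))
    {v : NNReal} (hv : v ≠ 0)
    (he : P.map (fun ω i => e i ω) = Measure.pi fun _ => gaussianReal 0 v)
    (hind : IndepFun (fun ω i => V i ω) (fun ω i => e i ω) P) :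
    P.map (fun ω => ((fun i => V i ω + e i ω), fun i => V i ω)) =
      (volume.prod (P.map fun ω i => V i ω)).withDensity fun q => lik v q.2 q.1 := by
  have hVv : Measurable fun ω i => V i ω := measurable_pi_lambda _ hVm
  have hev : Measurable fun ω i => e i ω := measurable_pi_lambda _ hem
  have : IsProbabilityMeasure (P.map fun ω i => V i ω) :=
    Measure.isProbabilityMeasure_map hVv.aemeasurable
  have hlik : Measurable fun q : (Fin n → ℝ) × (Fin n → ℝ) => lik v q.2 q.1 :=
    measurable_lik measurable_snd measurable_fst
  refine Measure.ext_of_lintegral _ fun F hF => ?_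
  have hjoint := hind.map_prod_eq_prod_map_map hVv.aemeasurable hev.aemeasurable
  rw [he] at hjoint
  have hF' : Measurable fun q : (Fin n → ℝ) × (Fin n → ℝ) => F (q.2, q.1) :=
    hF.comp measurable_swap
  have key := lintegral_noisy_prod (ν := P.map fun ω i => V i ω) (V := fun i a => a i) hv
    (fun i => measurable_pi_apply i) hF'
  rw [← hjoint, lintegral_map _ (hVv.prodMk hev)] at key
  · rw [lintegral_map hF (by fun_prop), key, lintegral_withDensity_eq_lintegral_mul _ hlik hF,
      lintegral_prod _ (hlik.mul hF).aemeasurable]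
    refine lintegral_congr fun y => lintegral_congr fun a => ?_
    exact mul_comm _ _
  · exact hF'.comp (by fun_prop : Measurable fun q : (Fin n → ℝ) × (Fin n → ℝ) =>
      (q.1, fun i => q.1 i + q.2 i))

/-- The logarithm of the density of the joint law of `(y, a)` (observation, signal) with respect to
the product of its marginals. -/
noncomputable def logRatio (σ : ℝ) (B : Matrix (Fin n) (Fin n) ℝ) (y a : Fin n → ℝ) : ℝ :=
  -n * Real.log σ - Real.log |B.det| - ∑ i, (y i - a i) ^ 2 / (2 * σ ^ 2) +
    ∑ i, (B *ᵥ y) i ^ 2 / 2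

lemma lik_eq_exp (v : NNReal) (a y : Fin n → ℝ) :
    lik v a y = ENNReal.ofReal ((√(2 * Real.pi * v))⁻¹ ^ n *
      Real.exp (-∑ i, (y i - a i) ^ 2 / (2 * v))) := by
  rw [lik_eq_ofReal]
  simp only [gaussianPDFReal, Finset.prod_mul_distrib, Finset.prod_const, Finset.card_univ,
    Fintype.card_fin, ← Real.exp_sum, neg_div, Finset.sum_neg_distrib]

lemma mul_exp_logRatio {σ : ℝ} (hσ : 0 < σ) {B : Matrix (Fin n) (Fin n) ℝ} (hdet : B.det ≠ 0)
    (y a : Fin n → ℝ) :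
    ENNReal.ofReal |B.det| * lik 1 0 (B *ᵥ y) * ENNReal.ofReal (Real.exp (logRatio σ B y a)) =
      lik (σ ^ 2).toNNReal a y := by
  rw [lik_eq_exp, lik_eq_exp, ← ENNReal.ofReal_mul (abs_nonneg _),
    ← ENNReal.ofReal_mul (by positivity), Real.coe_toNNReal _ (sq_nonneg σ)]
  congr 1
  have hd : 0 < |B.det| := abs_pos.2 hdet
  have h1 : √(2 * Real.pi * σ ^ 2) = √(2 * Real.pi * (1 : NNReal)) * σ := by
    rw [Real.sqrt_mul (by positivity), Real.sqrt_sq hσ.le]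
    simp
  have h2 : Real.exp (-n * Real.log σ) = σ⁻¹ ^ n := by
    rw [neg_mul, Real.exp_neg, ← Real.log_pow, Real.exp_log (by positivity), inv_pow]
  have h3 : Real.exp (Real.log |B.det|) = |B.det| := Real.exp_log hd
  rw [logRatio, Real.exp_add, Real.exp_sub, Real.exp_sub, h2, h3, h1, mul_inv, mul_pow,
    Real.exp_neg, Real.exp_neg]
  simp only [Pi.zero_apply, sub_zero, NNReal.coe_one, mul_one]
  field_simp

/-- The mutual information of a centred Gaussian vector `V` and its observation under independent
`N(0, σ²)` noise. -/
theorem klDiv_noisy (hVm : ∀ i, Measurable (V i)) (hem : ∀ i, Measurable (e i))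
    (hG : HasGaussianLaw (fun ω i => V i ω) P) (hV0 : ∀ i, ∫ ω, V i ω ∂P = 0) {σ : ℝ} (hσ : 0 < σ)
    (he : P.map (fun ω i => e i ω) = Measure.pi fun _ => gaussianReal 0 (σ ^ 2).toNNReal)
    (hind : IndepFun (fun ω i => V i ω) (fun ω i => e i ω) P) :
    InformationTheory.klDiv (P.map fun ω => ((fun i => V i ω + e i ω), fun i => V i ω))
      ((P.map fun ω i => V i ω + e i ω).prod (P.map fun ω i => V i ω)) =
      ENNReal.ofReal (Real.log (noisyCov P σ V).det / 2 - n * Real.log σ) := by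
  have hv : (σ ^ 2).toNNReal ≠ 0 := by simp [hσ.ne']
  have hL2 : ∀ i, MemLp (V i) 2 P := fun i => (hG.eval i).memLp_two
  have hVv : Measurable fun ω i => V i ω := measurable_pi_lambda _ hVm
  have hYm : ∀ i, Measurable fun ω => V i ω + e i ω := fun i => (hVm i).add (hem i)
  have hYv : Measurable fun ω i => V i ω + e i ω := measurable_pi_lambda _ hYm
  have hM := posDef_noisyCov hL2 hσ
  obtain ⟨B, hdet, hB, hBdet⟩ := exists_whitening hM
  have hG0 : HasGaussianLaw (fun ω => ((0 : ℝ), fun i => V i ω)) P :=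
    hG.map_fun ((0 : (Fin n → ℝ) →L[ℝ] ℝ).prod (ContinuousLinearMap.id ℝ _))
  have hind0 : IndepFun (fun ω => ((0 : ℝ), fun i => V i ω)) (fun ω i => e i ω) P :=
    hind.comp (φ := fun a : Fin n → ℝ => ((0 : ℝ), a)) (ψ := id) (by fun_prop) measurable_id
  have hGY := (noisy_hasGaussianLaw hG0 he hind0).snd
  have hY0 := noisy_integral hG0 hV0 (fun i => (hem i).aemeasurable) he
  have hcov := noisy_covariance hG0 (fun i => (hem i).aemeasurable) he hind0
  have hlawY := map_eq_withDensity_whitening hYm hGY hY0 hcov hB hdet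
  have hlawz := map_whitening hGY hY0 hcov hB
  have hjoint := map_joint_eq_withDensity hVm hem hv he hind
  set q : (Fin n → ℝ) → ℝ≥0∞ := fun y => ENNReal.ofReal |B.det| * lik 1 0 (B *ᵥ y)
  have hq : Measurable q := (measurable_lik measurable_const (by fun_prop)).const_mul _
  have : IsProbabilityMeasure (P.map fun ω i => V i ω) :=
    Measure.isProbabilityMeasure_map hVv.aemeasurable
  have : IsProbabilityMeasure (P.map fun ω i => V i ω + e i ω) :=
    Measure.isProbabilityMeasure_map hYv.aemeasurable
  set κ := (P.map fun ω i => V i ω + e i ω).prod (P.map fun ω i => V i ω) with hκ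
  set ρ : (Fin n → ℝ) × (Fin n → ℝ) → ℝ := fun p => logRatio σ B p.1 p.2
  have hρ : Measurable ρ := by
    have : Continuous ρ := by
      simp only [ρ, logRatio]
      have : Continuous fun p : (Fin n → ℝ) × (Fin n → ℝ) => B *ᵥ p.1 := by fun_prop
      fun_prop
    exact this.measurable
  have hr : Measurable fun p => ENNReal.ofReal (Real.exp (ρ p)) := by fun_prop
  have hden : (P.map fun ω => ((fun i => V i ω + e i ω), fun i => V i ω)) =
      κ.withDensity fun p => ENNReal.ofReal (Real.exp (ρ p)) := by
    rw [hκ, hlawY, prod_withDensity_left hq,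
      ← withDensity_mul (f := fun z : (Fin n → ℝ) × (Fin n → ℝ) => q z.1) _
        (hq.comp measurable_fst) hr,
      hjoint]
    congr 1
    ext1 p
    exact (mul_exp_logRatio hσ hdet p.1 p.2).symm
  have hJm : Measurable fun ω => ((fun i => V i ω + e i ω), fun i => V i ω) := hYv.prodMk hVv
  set J := P.map fun ω => ((fun i => V i ω + e i ω), fun i => V i ω)
  have hJp : IsProbabilityMeasure J := Measure.isProbabilityMeasure_map hJm.aemeasurable
  have hac : J ≪ κ := by rw [hden]; exact withDensity_absolutelyContinuous _ _
  have hllr : llr J κ =ᵐ[J] ρ := by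
    have h1 := Measure.rnDeriv_withDensity κ hr
    rw [← hden] at h1
    filter_upwards [hac.ae_le h1] with p hp
    rw [llr, hp, ENNReal.toReal_ofReal (Real.exp_pos _).le, Real.log_exp]
  -- The expectation of `ρ` only involves the second moments of the noise and of the whitened data.
  have heL : ∀ i, MemLp (e i) 2 P := fun i =>
    ((hasGaussianLaw_of_map_pi he).eval i).memLp_two
  set z : Fin n → Ω → ℝ := fun i ω => (B *ᵥ fun j => V j ω + e j ω) i
  have hzm : ∀ i, Measurable (z i) := fun i => by
    have : Measurable fun ω => B *ᵥ fun j => V j ω + e j ω := by fun_prop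
    exact (measurable_pi_apply i).comp this
  have hzL : ∀ i, MemLp (z i) 2 P := fun i =>
    ((hasGaussianLaw_of_map_pi (e := z) hlawz).eval i).memLp_two
  have hsq : ∀ {v : NNReal} {X : Ω → ℝ}, Measurable X → MemLp X 2 P →
      P.map X = gaussianReal 0 v → ∫ ω, X ω ^ 2 ∂P = v := by
    intro v X hX hXL hl
    have h0 : ∫ ω, X ω ∂P = 0 := by
      have := integral_map (f := fun x : ℝ => x) hX.aemeasurable (μ := P) (by fun_prop)
      rw [hl, integral_id_gaussianReal] at this
      exact this.symm
    rw [← variance_of_integral_eq_zero hX.aemeasurable h0, ← variance_id_map hX.aemeasurable, hl,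
      variance_id_gaussianReal]
  have he2 : ∀ i, ∫ ω, e i ω ^ 2 ∂P = σ ^ 2 := fun i => by
    rw [hsq (hem i) (heL i) (map_eval_of_map_pi (fun i => (hem i).aemeasurable) he i),
      Real.coe_toNNReal _ (sq_nonneg σ)]
  have hz2 : ∀ i, ∫ ω, z i ω ^ 2 ∂P = 1 := fun i => by
    rw [hsq (hzm i) (hzL i) (map_eval_of_map_pi (e := z) (fun i => (hzm i).aemeasurable) hlawz i),
      NNReal.coe_one]
  have hρω : ∀ ω, ρ ((fun i => V i ω + e i ω), fun i => V i ω) =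
      -n * Real.log σ - Real.log |B.det| - ∑ i, e i ω ^ 2 / (2 * σ ^ 2) + ∑ i, z i ω ^ 2 / 2 := by
    intro ω
    simp only [ρ, logRatio, add_sub_cancel_left, z]
  have hie : ∀ i, Integrable (fun ω => e i ω ^ 2 / (2 * σ ^ 2)) P := fun i =>
    (heL i).integrable_sq.div_const _
  have hiz : ∀ i, Integrable (fun ω => z i ω ^ 2 / 2) P := fun i =>
    (hzL i).integrable_sq.div_const _
  have hi1 : Integrable (fun ω => -n * Real.log σ - Real.log |B.det| -
      ∑ i, e i ω ^ 2 / (2 * σ ^ 2)) P :=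
    (integrable_const _).sub (integrable_finsetSum _ fun i _ => hie i)
  have hi2 : Integrable (fun ω => ∑ i, z i ω ^ 2 / 2) P :=
    integrable_finsetSum _ fun i _ => hiz i
  have hint : Integrable ρ J := by
    rw [integrable_map_measure hρ.aestronglyMeasurable hJm.aemeasurable]
    simp only [Function.comp_def, hρω]
    exact hi1.add hi2
  have hval : ∫ p, ρ p ∂J = Real.log (noisyCov P σ V).det / 2 - n * Real.log σ := by
    rw [integral_map hJm.aemeasurable hρ.aestronglyMeasurable]
    simp only [hρω]
    rw [integral_add hi1 hi2, integral_sub (integrable_const _)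
      (integrable_finsetSum _ fun i _ => hie i), integral_finsetSum _ fun i _ => hie i,
      integral_finsetSum _ fun i _ => hiz i]
    simp only [integral_div, he2, hz2]
    have hlog : Real.log |B.det| = -(Real.log (noisyCov P σ V).det / 2) := by
      have h1 : Real.log (|B.det| ^ 2) = Real.log ((noisyCov P σ V).det⁻¹) := by
        rw [sq_abs, hBdet]
      rw [Real.log_pow, Real.log_inv] at h1
      push_cast at h1
      linarith
    have hσ2 : σ ^ 2 / (2 * σ ^ 2) = 1 / 2 := by field_simp
    simp [hlog, hσ2]
    ring
  rw [InformationTheory.klDiv_of_ac_of_integrable hac ((integrable_congr hllr).2 hint),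
    integral_congr_ae hllr, hval]
  simp

end MutualInfo

/-! ### The maximum information gain -/

section InfoGain

open Matrix

variable {d n : ℕ} {k : Pt d → Pt d → ℝ} {σ : ℝ}

/-- Schur complement: adding a point multiplies the determinant of `K + σ² I` by its posterior
predictive variance. -/
lemma det_noisyGram_succ (X : Fin (n + 1) → Pt d)
    (hdet : (noisyGram k σ fun i : Fin n => X i.castSucc).det ≠ 0) :
    (noisyGram k σ X).det = (noisyGram k σ fun i : Fin n => X i.castSucc).det *
      (σ ^ 2 + postVar k σ (fun i : Fin n => X i.castSucc) (X (Fin.last n))) := by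
  set A := noisyGram k σ fun i : Fin n => X i.castSucc
  set z := X (Fin.last n)
  have hblock : (noisyGram k σ X).submatrix finSumFinEquiv finSumFinEquiv =
      fromBlocks A (of fun i (_ : Fin 1) => k (X i.castSucc) z)
        (of fun (_ : Fin 1) j => k z (X j.castSucc)) (of fun _ _ => k z z + σ ^ 2) := by
    have hl : ∀ i : Fin n, Fin.castSucc i ≠ Fin.last n := fun i => (Fin.castSucc_lt_last i).ne
    have hr : ∀ i : Fin 1, Fin.natAdd n i = Fin.last n := fun i => by
      rw [Subsingleton.elim i 0]; rfl
    have hc : ∀ i : Fin n, Fin.castAdd 1 i = i.castSucc := fun i => rfl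
    ext i j
    rcases i with i | i <;> rcases j with j | j
    · simp [noisyGram, A, Matrix.one_apply, hc]
    · simp [noisyGram, hc, hr, hl, z]
    · simp [noisyGram, hc, hr, (hl _).symm, z]
    · simp [noisyGram, hr, z]
  have : Invertible A := A.invertibleOfIsUnitDet hdet.isUnit
  rw [← det_submatrix_equiv_self finSumFinEquiv, hblock, det_fromBlocks₁₁, det_fin_one,
    invOf_eq_nonsing_inv]
  congr 1
  simp only [postVar, Matrix.sub_apply, Matrix.of_apply, Matrix.mul_assoc]
  have : ((of fun (_ : Fin 1) (j : Fin n) => k z (X j.castSucc)) *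
      (A⁻¹ * (of fun (i : Fin n) (_ : Fin 1) => k (X i.castSucc) z))) 0 0 =
      (fun i => k z (X (Fin.castSucc i))) ⬝ᵥ A⁻¹ *ᵥ fun i => k (X (Fin.castSucc i)) z := by
    simp [Matrix.mul_apply, dotProduct, mulVec]
  rw [this]
  ring

namespace IsGPEval

variable {W : Type*} [MeasurableSpace W] {ν : Measure W} {D : Set (Pt d)} {ev : W → D → ℝ}
  (h : IsGPEval ν ev k)
include h

lemma postVar_le (hσ : 0 < σ) (X : Fin n → D) (z : D) :
    postVar k σ (fun i => (X i : Pt d)) z ≤ k z z := by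
  have hs : (fun i => k (X i) z) = fun i => k z (X i) := funext fun i => h.symm _ _
  have := (h.posDef_noisyGram hσ X).inv.posSemidef.dotProduct_mulVec_nonneg fun i => k z (X i)
  simp only [star_trivial] at this
  rw [postVar, hs]
  linarith

/-- The information gain of a sequence of points is the sum over its points of the information
gained about the next value. -/
lemma log_det_noisyGram [IsProbabilityMeasure ν] (hσ : 0 < σ) (X : ℕ → D) (n : ℕ) :
    Real.log (noisyGram k σ fun i : Fin n => (X i : Pt d)).det / 2 - n * Real.log σ =
      ∑ t ∈ Finset.range n,
        Real.log (1 + postVar k σ (fun i : Fin t => (X i : Pt d)) (X t) / σ ^ 2) / 2 := by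
  induction n with
  | zero => simp
  | succ n ih =>
    have hd := (h.posDef_noisyGram hσ fun i : Fin n => X i).det_pos
    have hv := h.postVar_nonneg hσ (fun i : Fin n => X i) (X n)
    have hdet := det_noisyGram_succ (k := k) (σ := σ) (fun i : Fin (n + 1) => (X i : Pt d)) hd.ne'
    simp only [Fin.val_castSucc, Fin.val_last] at hdet
    have h1 : σ ^ 2 + postVar k σ (fun i : Fin n => (X i : Pt d)) (X n) =
        σ ^ 2 * (1 + postVar k σ (fun i : Fin n => (X i : Pt d)) (X n) / σ ^ 2) := by
      field_simp
    rw [Finset.sum_range_succ, ← ih, hdet, h1, Real.log_mul hd.ne' (by positivity),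
      Real.log_mul (by positivity) (by positivity), Real.log_pow]
    push_cast
    ring

end IsGPEval

/-- Tuples of distinct points are dense in the tuples of points of a compact connected space with
more than one point. -/
lemma dense_injective {E : Type*} [TopologicalSpace E] [T2Space E] [CompactSpace E]
    [ConnectedSpace E] [Nontrivial E] (n : ℕ) : Dense {X : Fin n → E | Function.Injective X} := by
  have h1 : ∀ p : {p : Fin n × Fin n // p.1 ≠ p.2},
      IsOpen {X : Fin n → E | X p.1.1 ≠ X p.1.2} := fun p =>
    isOpen_ne_fun (continuous_apply _) (continuous_apply _)
  have h2 : ∀ p : {p : Fin n × Fin n // p.1 ≠ p.2}, Dense {X : Fin n → E | X p.1.1 ≠ X p.1.2} := by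
    rintro ⟨⟨i, j⟩, hij⟩ X
    have hc : Continuous fun w : E => Function.update X i w :=
      continuous_const.update i continuous_id
    have hX := image_closure_subset_closure_image hc
      (Set.mem_image_of_mem _ (dense_compl_singleton (X j) (X i)))
    simp only [Function.update_eq_self] at hX
    refine closure_mono ?_ hX
    rintro _ ⟨w, hw, rfl⟩
    have hji : j ≠ i := fun h => hij h.symm
    simpa [Function.update_of_ne hji] using hw
  refine (dense_iInter_of_isOpen h1 h2).mono fun X hX i j hij => ?_
  by_contra hne
  exact Set.mem_iInter.1 hX ⟨(i, j), hne⟩ hij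

section Model

variable {Ω : Type*} [MeasurableSpace Ω] {P : Measure Ω} [IsProbabilityMeasure P]
  {f : Pt d → Ω → ℝ} {ε : ℕ → Ω → ℝ} {D : Set (Pt d)}

lemma mutualInfo_eq (hM : IsGPModel P f ε D k σ) (hσ : 0 < σ) (X : Fin n → D) :
    mutualInfo P (fun ω i => f (X i) ω + ε i ω) (fun ω i => f (X i) ω) =
      ENNReal.ofReal (Real.log (noisyGram k σ fun i => (X i : Pt d)).det / 2 - n * Real.log σ) := by
  have hi : iIndepFun (fun (i : Fin n) => ε i) P := hM.noise_indep.precomp Fin.val_injective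
  have he := iIndepFun.map_fun_eq_pi_map (f := fun i : Fin n => ε i)
    (fun i => (hM.measurable_noise i).aemeasurable) hi
  simp only [hM.noise_law] at he
  have hind : IndepFun (fun ω i => f (X i) ω) (fun ω (i : Fin n) => ε i ω) P :=
    hM.indep.comp (φ := fun w : D → ℝ => fun i => w (X i))
      (ψ := fun e : ℕ → ℝ => fun i : Fin n => e i)
      (by fun_prop) (by fun_prop)
  have hG : HasGaussianLaw (fun ω i => f (X i) ω) P := by
    cases n with
    | zero =>
      exact HasGaussianLaw.of_subsingleton
    | succ n => exact (hasGaussianLaw_of_isGaussianProcess hM.gaussian (X 0) X).snd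
  have hcov : noisyCov P σ (fun i => f (X i)) = noisyGram k σ fun i => (X i : Pt d) := by
    simp only [noisyCov, noisyGram, hM.covariance_eq _ (X _).2 _ (X _).2]
  rw [← hcov]
  exact klDiv_noisy (V := fun i => f (X i)) (e := fun i => ε i)
    (fun i => hM.measurable_f _ (X i).2) (fun i => hM.measurable_noise i) hG
    (fun i => hM.mean_zero _ (X i).2) hσ he hind

variable (hM : IsGPModel P f ε D k σ) (hcont : ∀ᵐ ω ∂P, ContinuousOn (fun z => f z ω) D)
  (hσ : 0 < σ)
include hM hcont hσ

lemma maxInfoGain_ne_top (hk : ∀ z ∈ D, k z z ≤ 1) (n : ℕ) : maxInfoGain P f ε D n ≠ ⊤ := by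
  refine ne_top_of_le_ne_top (b := ENNReal.ofReal (n * (Real.log (1 + (σ ^ 2)⁻¹) / 2)))
    ENNReal.ofReal_ne_top ?_
  refine iSup_le fun A => iSup_le fun _ => iSup_le fun hA => ?_
  have hX := mutualInfo_eq hM hσ (n := n) fun i => ⟨A i, hA i⟩
  rw [hX]
  refine ENNReal.ofReal_le_ofReal ?_
  cases n with
  | zero => simp
  | succ n =>
    have : Nonempty D := ⟨⟨A 0, hA 0⟩⟩
    have hev := isGPEval_path hM hcont
    have : IsProbabilityMeasure (P.map fun ω (x : D) => f x ω) :=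
      Measure.isProbabilityMeasure_map (measurable_path hM).aemeasurable
    set X : ℕ → D := fun m => if hm : m < n + 1 then ⟨A ⟨m, hm⟩, hA _⟩ else ⟨A 0, hA 0⟩
    have hlog := hev.log_det_noisyGram hσ X (n + 1)
    have hXA : (fun i : Fin (n + 1) => (X i : Pt d)) = A := funext fun i => by
      simp only [X, i.is_lt, dif_pos]
    rw [hXA] at hlog
    rw [hlog]
    refine (Finset.sum_le_card_nsmul _ _ _ fun t _ => ?_).trans_eq (by
      rw [Finset.card_range, nsmul_eq_mul])
    have h1 := hev.postVar_nonneg hσ (fun i : Fin t => X i) (X t)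
    rw [inv_eq_one_div]
    gcongr
    exact (hev.postVar_le hσ _ _).trans (hk _ (X t).2)

/-- Repetitions do not help: by density of the tuples of distinct points, the information gained
along any sequence is at most the maximum information gain. -/
lemma sum_log_le_maxInfoGain (hD : IsCompact D) (hconv : Convex ℝ D) (hnt : D.Nontrivial)
    (hk : ∀ z ∈ D, k z z ≤ 1) (X : ℕ → D) (n : ℕ) :
    ∑ t ∈ Finset.range n,
      Real.log (1 + postVar k σ (fun i : Fin t => (X i : Pt d)) (X t) / σ ^ 2) / 2 ≤
      (maxInfoGain P f ε D n).toReal := by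
  have : Nontrivial D := hnt.coe_sort
  have : CompactSpace D := isCompact_iff_compactSpace.1 hD
  have : ConnectedSpace D := isConnected_iff_connectedSpace.1
    ⟨hnt.nonempty, hconv.isPreconnected⟩
  have hev := isGPEval_path hM hcont
  have : IsProbabilityMeasure (P.map fun ω (x : D) => f x ω) :=
    Measure.isProbabilityMeasure_map (measurable_path hM).aemeasurable
  rw [← hev.log_det_noisyGram hσ]
  have hc : Continuous fun A : Fin n → D =>
      Real.log (noisyGram k σ fun i => (A i : Pt d)).det / 2 - n * Real.log σ :=
    (((hev.continuous_noisyGram n σ).matrix_det.log fun A =>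
      (hev.posDef_noisyGram hσ A).det_pos.ne').div_const 2).sub continuous_const
  refine (isClosed_le hc continuous_const).closure_subset_iff.2 ?_
    (dense_injective n fun i : Fin n => X i)
  intro A hA
  refine ENNReal.ofReal_le_iff_le_toReal (maxInfoGain_ne_top hM hcont hσ hk n) |>.1 ?_
  rw [← mutualInfo_eq hM hσ A]
  exact le_iSup₂_of_le (fun i => (A i : Pt d)) (Subtype.val_injective.comp hA)
    (le_iSup_of_le (fun i => (A i).2) le_rfl)

lemma log_le_maxInfoGain (hD : IsCompact D) (hconv : Convex ℝ D) (hnt : D.Nontrivial)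
    (hk : ∀ z ∈ D, k z z ≤ 1) {z : Pt d} (hz : z ∈ D) {v : ℝ} (hv : 0 < v) (hvz : v ≤ k z z)
    (hn : 1 ≤ n) :
    Real.log (1 + v / σ ^ 2) / 2 ≤ (maxInfoGain P f ε D n).toReal := by
  refine le_trans ?_ (sum_log_le_maxInfoGain hM hcont hσ hD hconv hnt hk (fun _ => ⟨z, hz⟩) n)
  have : Nonempty D := ⟨⟨z, hz⟩⟩
  have hev := isGPEval_path hM hcont
  have : IsProbabilityMeasure (P.map fun ω (x : D) => f x ω) :=
    Measure.isProbabilityMeasure_map (measurable_path hM).aemeasurable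
  have h0 : postVar k σ (fun _ : Fin 0 => z) z = k z z := by simp [postVar]
  refine le_trans ?_ (Finset.single_le_sum (a := 0) (fun t _ => ?_) (Finset.mem_range.2 hn))
  · simp only [h0]
    gcongr
  · have := hev.postVar_nonneg hσ (fun _ : Fin t => ⟨z, hz⟩) ⟨z, hz⟩
    have : 0 ≤ Real.log (1 + postVar k σ (fun _ : Fin t => z) z / σ ^ 2) :=
      Real.log_nonneg (by simp only at this; have := div_nonneg this (sq_nonneg σ); linarith)
    positivity

end Model

end InfoGain

/-! ### Lipschitz paths and nets -/

section Geometry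

variable {d : ℕ} {D : Set (Pt d)} {r : ℝ}

lemma norm_le_of_coord {w : Pt d} {c : ℝ} (hc : 0 ≤ c) (hw : ∀ j, |w j| ≤ c) : ‖w‖ ≤ √d * c := by
  rw [EuclideanSpace.norm_eq]
  refine Real.sqrt_le_iff.2 ⟨by positivity, ?_⟩
  refine (Finset.sum_le_card_nsmul _ _ (c ^ 2) fun j _ => ?_).trans_eq ?_
  · rw [Real.norm_eq_abs]
    gcongr
    exact hw j
  · rw [mul_pow, Real.sq_sqrt (Nat.cast_nonneg d), Finset.card_univ, Fintype.card_fin, nsmul_eq_mul]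

lemma abs_sub_le_of_gradient (hconv : Convex ℝ D) {g : Pt d → ℝ} {G : Pt d → Pt d}
    (hg : ∀ x ∈ D, HasGradientWithinAt g (G x) D x) {L : ℝ} (hL0 : 0 ≤ L)
    (hL : ∀ x ∈ D, ∀ j, |G x j| ≤ L) {z z' : Pt d} (hz : z ∈ D) (hz' : z' ∈ D) :
    |g z - g z'| ≤ √d * L * ‖z - z'‖ := by
  refine hconv.norm_image_sub_le_of_norm_hasFDerivWithin_le
    (fun x hx => (hg x hx).hasFDerivWithinAt) (fun x hx => ?_) hz' hz
  rw [LinearIsometryEquiv.norm_map]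
  exact norm_le_of_coord hL0 (hL x hx)

/-- A point outside a closed convex set can be replaced by a point of the set that is at least as
close to every point of the set. -/
lemma exists_proj (hD : IsCompact D) (hconv : Convex ℝ D) (hne : D.Nonempty) (c : Pt d) :
    ∃ p ∈ D, ∀ z ∈ D, ‖z - p‖ ≤ ‖z - c‖ := by
  obtain ⟨p, hp, hmin⟩ := exists_norm_eq_iInf_of_complete_convex hne hD.isComplete hconv c
  refine ⟨p, hp, fun z hz => ?_⟩
  have hin := (norm_eq_iInf_iff_real_inner_le_zero hconv hp).1 hmin z hz
  have h1 : z - c = (z - p) - (c - p) := by abel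
  have h2 : ‖z - c‖ ^ 2 = ‖z - p‖ ^ 2 - 2 * inner ℝ (c - p) (z - p) + ‖c - p‖ ^ 2 := by
    rw [h1, norm_sub_sq_real, real_inner_comm]
  refine (sq_le_sq₀ (norm_nonneg _) (norm_nonneg _)).1 ?_
  nlinarith [sq_nonneg ‖c - p‖]

lemma exists_cell (hr : 0 < r) {m : ℕ} (hm : 0 < m) {u : ℝ} (hu : u ∈ Set.Icc 0 r) :
    ∃ i : Fin m, |u - r * (i + 1 / 2) / m| ≤ r / (2 * m) := by
  have hm' : (0 : ℝ) < m := by positivity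
  set q := u * m / r
  have hq0 : 0 ≤ q := by have := hu.1; positivity
  have hqm : q ≤ m := by
    rw [div_le_iff₀ hr, mul_comm]
    exact mul_le_mul_of_nonneg_left hu.2 hm'.le
  have huq : u = r * q / m := by simp only [q]; field_simp
  suffices ∃ i : Fin m, |q - (i + 1 / 2)| ≤ 1 / 2 by
    obtain ⟨i, hi⟩ := this
    refine ⟨i, ?_⟩
    rw [huq, ← sub_div, ← mul_sub, abs_div, abs_mul, abs_of_pos hr, abs_of_pos hm']
    calc r * |q - (i + 1 / 2)| / m ≤ r * (1 / 2) / m := by gcongr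
      _ = r / (2 * m) := by field_simp
  rcases hqm.lt_or_eq with h | h
  · refine ⟨⟨⌊q⌋₊, (Nat.floor_lt hq0).2 h⟩, ?_⟩
    have h1 := Nat.floor_le hq0
    have h2 := Nat.lt_floor_add_one q
    rw [abs_le]
    constructor <;> linarith
  · refine ⟨⟨m - 1, by omega⟩, ?_⟩
    rw [h, Nat.cast_sub hm, Nat.cast_one, abs_le]
    constructor <;> linarith

/-- A convex subset of the cube `[0, r]^d` has a net of at most `τ ^ d` points at distance at most
`√d r / τ`: the projections of the centres of `⌈τ / 2⌉ ^ d` cells. -/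
lemma exists_net (hD : IsCompact D) (hconv : Convex ℝ D) (hne : D.Nonempty) (hr : 0 < r)
    (hcube : ∀ x ∈ D, ∀ j, x j ∈ Set.Icc 0 r) {τ : ℝ} (hτ : 1 ≤ τ) :
    ∃ S : Finset (Pt d), (S.card : ℝ) ≤ τ ^ d ∧ (∀ z ∈ S, z ∈ D) ∧
      ∀ z ∈ D, ∃ z' ∈ S, ‖z - z'‖ ≤ √d * (r / τ) := by
  classical
  set m := ⌈τ / 2⌉₊
  have hm : 0 < m := Nat.ceil_pos.2 (by linarith)
  have hm' : (0 : ℝ) < m := by positivity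
  have hle : τ / 2 ≤ m := Nat.le_ceil _
  have hge : (m : ℝ) ≤ τ := by
    rcases le_or_gt τ 2 with h | h
    · have : m ≤ 1 := Nat.ceil_le.2 (by push_cast; linarith)
      exact le_trans (by exact_mod_cast this) hτ
    · have := Nat.ceil_lt_add_one (a := τ / 2) (by linarith)
      linarith
  choose p hpD hp using exists_proj hD hconv hne
  set c : (Fin d → Fin m) → Pt d := fun I => WithLp.toLp 2 fun j => r * (I j + 1 / 2) / m
  refine ⟨Finset.univ.image fun I => p (c I), ?_, ?_, fun z hz => ?_⟩
  · have : (Finset.univ.image fun I => p (c I)).card ≤ m ^ d :=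
      Finset.card_image_le.trans_eq (by simp)
    calc ((Finset.univ.image fun I => p (c I)).card : ℝ) ≤ (m : ℝ) ^ d := by exact_mod_cast this
      _ ≤ τ ^ d := by gcongr
  · simp only [Finset.mem_image, Finset.mem_univ, true_and]
    rintro _ ⟨I, rfl⟩
    exact hpD _
  · choose I hI using fun j => exists_cell hr hm (hcube z hz j)
    refine ⟨p (c I), Finset.mem_image_of_mem _ (Finset.mem_univ _), (hp _ z hz).trans ?_⟩
    refine (norm_le_of_coord (c := r / (2 * m)) (by positivity) fun j => hI j).trans ?_
    gcongr
    linarith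

end Geometry

/-! ### The good event -/

section GoodEvent

/-- The argument `τ_t` of the second logarithm in `β_t`. In round `t` the paths are controlled on a
net of `D` of mesh proportional to `1 / τ_t`. -/
noncomputable def resolution (d : ℕ) (a b r δ : ℝ) (t : ℕ) : ℝ :=
  (t : ℝ) ^ 2 * d * b * r * √(Real.log (4 * d * a / δ))

variable {d : ℕ} {a b r δ : ℝ}

lemma resolution_mono (hb : 0 < b) (hr : 0 < r) : Monotone (resolution d a b r δ) := by
  intro s t hst
  have : (s : ℝ) ≤ t := by exact_mod_cast hst
  unfold resolution
  gcongr

lemma one_le_log_arg (hδ₀ : 0 < δ) (hδ₁ : δ < 1) {t : ℕ} (ht : 1 ≤ t) :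
    1 ≤ (t : ℝ) ^ 2 * Real.pi ^ 2 / (3 * δ) := by
  have ht' : (1 : ℝ) ≤ t := by exact_mod_cast ht
  have h1 : (1 : ℝ) ≤ (t : ℝ) ^ 2 := one_le_pow₀ ht'
  have h2 : (9 : ℝ) ≤ Real.pi ^ 2 := by nlinarith [Real.pi_gt_three]
  rw [le_div_iff₀ (by positivity)]
  nlinarith

lemma beta_nonneg (hδ₀ : 0 < δ) (hδ₁ : δ < 1) {t : ℕ} (ht : 1 ≤ t)
    (hτ : 1 ≤ resolution d a b r δ t) : 0 ≤ beta d a b r δ t := by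
  have h1 := Real.log_nonneg (one_le_log_arg hδ₀ hδ₁ ht)
  have h2 := Real.log_nonneg hτ
  rw [resolution] at h2
  rw [beta]
  positivity

lemma beta_le_beta (hb : 0 < b) (hr : 0 < r) (hδ₀ : 0 < δ) {s t : ℕ} (hs : 1 ≤ s) (hst : s ≤ t)
    (hτ : 1 ≤ resolution d a b r δ s) : beta d a b r δ s ≤ beta d a b r δ t := by
  have hs' : (1 : ℝ) ≤ s := by exact_mod_cast hs
  have hst' : (s : ℝ) ≤ t := by exact_mod_cast hst
  have h1 := Real.log_le_log (by linarith) (resolution_mono (d := d) (a := a) (δ := δ) hb hr hst)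
  unfold resolution at h1
  unfold beta
  gcongr

lemma exp_neg_half_beta (hδ₀ : 0 < δ) {t : ℕ} (ht : 1 ≤ t) (hτ : 1 ≤ resolution d a b r δ t) :
    resolution d a b r δ t ^ d * Real.exp (-beta d a b r δ t / 2) =
      3 * δ / (Real.pi ^ 2 * (t : ℝ) ^ 2) := by
  have ht' : (1 : ℝ) ≤ t := by exact_mod_cast ht
  have hτ0 : 0 < resolution d a b r δ t := by linarith
  have hA : 0 < (t : ℝ) ^ 2 * Real.pi ^ 2 / (3 * δ) := by positivity
  have hβ : -beta d a b r δ t / 2 = -Real.log ((t : ℝ) ^ 2 * Real.pi ^ 2 / (3 * δ)) -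
      Real.log (resolution d a b r δ t ^ d) := by
    rw [beta, Real.log_pow, resolution]
    ring
  rw [hβ, Real.exp_sub, Real.exp_neg, Real.exp_log hA, Real.exp_log (by positivity)]
  field_simp

lemma hasSum_inv_sq_succ (c : ℝ) :
    HasSum (fun n : ℕ => c * (1 / ((n : ℝ) + 1) ^ 2)) (c * (Real.pi ^ 2 / 6)) := by
  refine HasSum.mul_left c ?_
  have := (hasSum_nat_add_iff' 1).2 hasSum_zeta_two
  simpa using this

variable {Ω : Type*} [MeasurableSpace Ω] {P : Measure Ω}
  {f : Pt d → Ω → ℝ} {ε : ℕ → Ω → ℝ} {D : Set (Pt d)} {k : Pt d → Pt d → ℝ} {σ : ℝ}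
  {G : Pt d → Ω → Pt d} {pol : (n : ℕ) → (Fin n → Pt d × ℝ) → Pt d} {x : ℕ → Ω → Pt d}
  {y : ℕ → Ω → ℝ}

lemma HasPartialTails.tail_of_nonneg (hT : HasPartialTails P f G D a b) (ha : 0 < a) (j : Fin d)
    {L : ℝ} (hL : 0 ≤ L) : P {ω | ENNReal.ofReal L < ⨆ x ∈ D, ‖G x ω j‖ₑ} ≤
      ENNReal.ofReal (a * Real.exp (-(L / b) ^ 2)) := by
  rcases hL.lt_or_eq with h | rfl
  · exact hT.tail j L h
  -- The bound at level `0` is the limit of the bounds at the levels `1 / (m + 1)`.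
  have hU : {ω | ENNReal.ofReal 0 < ⨆ x ∈ D, ‖G x ω j‖ₑ} =
      ⋃ m : ℕ, {ω | ENNReal.ofReal (1 / ((m : ℝ) + 1)) < ⨆ x ∈ D, ‖G x ω j‖ₑ} := by
    ext ω
    simp only [Set.mem_ofPred_eq, Set.mem_iUnion, ENNReal.ofReal_zero]
    refine ⟨fun h => ?_, fun ⟨m, hm⟩ => bot_le.trans_lt hm⟩
    have ht : Filter.Tendsto (fun m : ℕ => ENNReal.ofReal (1 / ((m : ℝ) + 1))) Filter.atTop
        (nhds 0) := by
      rw [← ENNReal.ofReal_zero]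
      exact ENNReal.tendsto_ofReal tendsto_one_div_add_atTop_nhds_zero_nat
    exact (ht.eventually_lt_const h).exists
  have hmono : Monotone fun m : ℕ =>
      {ω | ENNReal.ofReal (1 / ((m : ℝ) + 1)) < ⨆ x ∈ D, ‖G x ω j‖ₑ} := by
    intro m m' hmm ω hω
    have : (m : ℝ) ≤ m' := by exact_mod_cast hmm
    refine lt_of_le_of_lt (ENNReal.ofReal_le_ofReal ?_) hω
    gcongr
  rw [hU, hmono.measure_iUnion]
  refine iSup_le fun m => (hT.tail j _ (by positivity)).trans (ENNReal.ofReal_le_ofReal ?_)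
  refine mul_le_mul_of_nonneg_left (Real.exp_le_exp.2 (neg_le_neg ?_)) ha.le
  rw [zero_div, zero_pow two_ne_zero]
  positivity

/-- Up to probability `δ / 4`, all partial derivatives are bounded by `b √(log (4 d a / δ))`. -/
lemma gradient_failure (hT : HasPartialTails P f G D a b) (ha : 0 < a) (hb : 0 < b) (hδ : 0 < δ) :
    P {ω | ∃ j, ENNReal.ofReal (b * √(Real.log (4 * d * a / δ))) < ⨆ x ∈ D, ‖G x ω j‖ₑ} ≤
      ENNReal.ofReal (δ / 4) := by
  have hj : ∀ j : Fin d, P {ω | ENNReal.ofReal (b * √(Real.log (4 * d * a / δ))) <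
      ⨆ x ∈ D, ‖G x ω j‖ₑ} ≤ ENNReal.ofReal (δ / (4 * d)) := by
    intro j
    have hd : (0 : ℝ) < d := by exact_mod_cast j.pos
    refine (hT.tail_of_nonneg ha j (by positivity)).trans (ENNReal.ofReal_le_ofReal ?_)
    have hu : 0 < 4 * d * a / δ := by positivity
    have h1 : Real.log (4 * d * a / δ) ≤ √(Real.log (4 * d * a / δ)) ^ 2 := by
      rcases le_or_gt 0 (Real.log (4 * d * a / δ)) with h | h
      · rw [Real.sq_sqrt h]
      · exact h.le.trans (sq_nonneg _)
    rw [mul_div_cancel_left₀ _ hb.ne']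
    calc a * Real.exp (-√(Real.log (4 * d * a / δ)) ^ 2)
        ≤ a * Real.exp (-Real.log (4 * d * a / δ)) := by gcongr
      _ = δ / (4 * d) := by
          rw [Real.exp_neg, Real.exp_log hu]
          field_simp
  have hU : {ω | ∃ j, ENNReal.ofReal (b * √(Real.log (4 * d * a / δ))) < ⨆ x ∈ D, ‖G x ω j‖ₑ} =
      ⋃ j : Fin d, {ω | ENNReal.ofReal (b * √(Real.log (4 * d * a / δ))) <
        ⨆ x ∈ D, ‖G x ω j‖ₑ} := by
    ext ω
    simp
  rw [hU]
  refine (measure_iUnion_fintype_le _ _).trans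
    ((Finset.sum_le_card_nsmul _ _ _ fun j _ => hj j).trans ?_)
  rw [Finset.card_univ, Fintype.card_fin, nsmul_eq_mul, ← ENNReal.ofReal_natCast,
    ← ENNReal.ofReal_mul (Nat.cast_nonneg d)]
  refine ENNReal.ofReal_le_ofReal ?_
  rcases Nat.eq_zero_or_pos d with rfl | hd
  · rw [Nat.cast_zero, zero_mul]
    positivity
  · have : (0 : ℝ) < d := by exact_mod_cast hd
    refine le_of_eq ?_
    field_simp

variable [IsProbabilityMeasure P]

/-- Up to probability `3 δ / (π² t²)`, in round `t = n + 1` the upper confidence bounds hold on a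
net of at most `τ_t ^ d` points and the lower confidence bound holds at the query point. -/
lemma round_failure (hM : IsGPModel P f ε D k σ) (hcont : ∀ᵐ ω ∂P, ContinuousOn (fun z => f z ω) D)
    (hR : IsRun f ε D k σ (beta d a b r δ) pol x y) (hD : MeasurableSet D) (hσ : 0 < σ)
    (hδ₀ : 0 < δ) (hδ₁ : δ < 1) (n : ℕ) (hτ : 1 ≤ resolution d a b r δ (n + 1))
    {S : Finset (Pt d)} (hS : (S.card : ℝ) ≤ resolution d a b r δ (n + 1) ^ d)
    (hSD : ∀ z ∈ S, z ∈ D) :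
    P {ω | (∃ z ∈ S, postMean k σ (fun i : Fin n => x i ω) (fun i => y i ω) z +
          √(beta d a b r δ (n + 1)) * postSD k σ (fun i : Fin n => x i ω) z < f z ω) ∨
        f (x n ω) ω < postMean k σ (fun i : Fin n => x i ω) (fun i => y i ω) (x n ω) -
          √(beta d a b r δ (n + 1)) * postSD k σ (fun i : Fin n => x i ω) (x n ω)} ≤
      ENNReal.ofReal (3 * δ / Real.pi ^ 2 * (1 / ((n : ℝ) + 1) ^ 2)) := by
  set β := beta d a b r δ (n + 1)
  set τ := resolution d a b r δ (n + 1)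
  have hn : 1 ≤ n + 1 := by omega
  have hβ : 0 ≤ β := beta_nonneg hδ₀ hδ₁ hn hτ
  have hexp : τ ^ d * Real.exp (-β / 2) = 3 * δ / (Real.pi ^ 2 * ((n : ℝ) + 1) ^ 2) := by
    have := exp_neg_half_beta hδ₀ hn hτ
    push_cast at this
    exact this
  have hup : P {ω | ∃ z ∈ S, postMean k σ (fun i : Fin n => x i ω) (fun i => y i ω) z +
      √β * postSD k σ (fun i : Fin n => x i ω) z < f z ω} ≤
      ENNReal.ofReal (τ ^ d * (1 / 2 * Real.exp (-β / 2))) := by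
    have hU : {ω | ∃ z ∈ S, postMean k σ (fun i : Fin n => x i ω) (fun i => y i ω) z +
        √β * postSD k σ (fun i : Fin n => x i ω) z < f z ω} =
        ⋃ z ∈ S, {ω | postMean k σ (fun i : Fin n => x i ω) (fun i => y i ω) z +
          √β * postSD k σ (fun i : Fin n => x i ω) z < f z ω} := by
      ext ω
      simp
    rw [hU]
    refine (measure_biUnion_finset_le _ _).trans ((Finset.sum_le_card_nsmul _ _ _ fun z hz =>
      run_upper hM hcont hR hD hσ n (hSD z hz) (Real.sqrt_nonneg β)).trans ?_)
    rw [nsmul_eq_mul, ← ENNReal.ofReal_natCast, ← ENNReal.ofReal_mul (Nat.cast_nonneg _),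
      Real.sq_sqrt hβ]
    gcongr
  have hlow := run_lower hM hcont hR hD hσ n (Real.sqrt_nonneg β)
  rw [Real.sq_sqrt hβ] at hlow
  refine (measure_union_le _ _).trans ((add_le_add hup hlow).trans ?_)
  rw [← ENNReal.ofReal_add (by positivity) (by positivity)]
  refine ENNReal.ofReal_le_ofReal ?_
  have h1 : Real.exp (-β / 2) ≤ τ ^ d * Real.exp (-β / 2) :=
    le_mul_of_one_le_left (Real.exp_pos _).le (one_le_pow₀ hτ)
  calc _ ≤ τ ^ d * Real.exp (-β / 2) := by linarith
    _ = _ := by rw [hexp]; field_simp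

/-- Up to probability `δ`, the instantaneous regret of every round `t = n + 1` is at most `1 / t²`
plus twice the width of the confidence interval at the query point; the second term is absent as
long as `τ_t < 1`, since the oscillation of the paths is then at most `1 / t²`. -/
theorem exists_good_event (ha : 0 < a) (hb : 0 < b) (hr : 0 < r) (hδ₀ : 0 < δ) (hδ₁ : δ < 1)
    (hσ : 0 < σ) (hD : IsCompact D) (hconv : Convex ℝ D) (hcube : ∀ x ∈ D, ∀ j, x j ∈ Set.Icc 0 r)
    (hM : IsGPModel P f ε D k σ) (hT : HasPartialTails P f G D a b)
    (hR : IsRun f ε D k σ (beta d a b r δ) pol x y) :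
    ∃ N : Set Ω, P N ≤ ENNReal.ofReal δ ∧ ∀ ω ∉ N, ∀ n, ∀ z ∈ D,
      f z ω - f (x n ω) ω ≤ (if 1 ≤ resolution d a b r δ (n + 1) then
        2 * (√(beta d a b r δ (n + 1)) * postSD k σ (fun i : Fin n => x i ω) (x n ω)) else 0) +
          1 / ((n : ℝ) + 1) ^ 2 := by
  obtain ⟨ω₀⟩ : Nonempty Ω := nonempty_of_isProbabilityMeasure P
  have hne : D.Nonempty := ⟨x 0 ω₀, hR.mem 0 ω₀⟩
  have hcont : ∀ᵐ ω ∂P, ContinuousOn (fun z => f z ω) D := by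
    filter_upwards [hT.hasGradient] with ω hω z hz using (hω z hz).continuousWithinAt
  set τ := resolution d a b r δ
  set L := b * √(Real.log (4 * d * a / δ))
  have hL : 0 ≤ L := by positivity
  have hτL : ∀ n : ℕ, τ (n + 1) = ((n : ℝ) + 1) ^ 2 * (d * L * r) := fun n => by
    simp only [τ, resolution, L]
    push_cast
    ring
  choose S hS hSD hnet using fun (n : ℕ) (h : 1 ≤ τ (n + 1)) =>
    exists_net hD hconv hne hr hcube h
  set N₁ : Set Ω := {ω | ¬ ∀ x ∈ D, HasGradientWithinAt (fun z => f z ω) (G x ω) D x}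
  set N₂ : Set Ω := {ω | ∃ j, ENNReal.ofReal L < ⨆ x ∈ D, ‖G x ω j‖ₑ}
  set N₃ : ℕ → Set Ω := fun n => {ω | ∃ h : 1 ≤ τ (n + 1),
    (∃ z ∈ S n h, postMean k σ (fun i : Fin n => x i ω) (fun i => y i ω) z +
        √(beta d a b r δ (n + 1)) * postSD k σ (fun i : Fin n => x i ω) z < f z ω) ∨
      f (x n ω) ω < postMean k σ (fun i : Fin n => x i ω) (fun i => y i ω) (x n ω) -
        √(beta d a b r δ (n + 1)) * postSD k σ (fun i : Fin n => x i ω) (x n ω)}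
  have hN₁ : P N₁ = 0 := ae_iff.1 hT.hasGradient
  have hN₂ : P N₂ ≤ ENNReal.ofReal (δ / 4) := gradient_failure hT ha hb hδ₀
  have hN₃ : ∀ n, P (N₃ n) ≤
      ENNReal.ofReal (3 * δ / Real.pi ^ 2 * (1 / ((n : ℝ) + 1) ^ 2)) := by
    intro n
    by_cases h : 1 ≤ τ (n + 1)
    · refine (measure_mono fun ω hω => ?_).trans (round_failure hM hcont hR hD.measurableSet hσ
        hδ₀ hδ₁ n h (hS n h) (hSD n h))
      exact hω.2
    · have : N₃ n = ∅ := Set.eq_empty_of_forall_notMem fun ω hω => h hω.1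
      rw [this, measure_empty]
      exact bot_le
  refine ⟨N₁ ∪ N₂ ∪ ⋃ n, N₃ n, ?_, fun ω hω n z hz => ?_⟩
  · have h3 : P (⋃ n, N₃ n) ≤ ENNReal.ofReal (δ / 2) := by
      have hs := hasSum_inv_sq_succ (3 * δ / Real.pi ^ 2)
      refine (measure_iUnion_le _).trans ((ENNReal.tsum_le_tsum hN₃).trans_eq ?_)
      rw [← ENNReal.ofReal_tsum_of_nonneg (fun n => by positivity) hs.summable, hs.tsum_eq]
      congr 1
      field_simp
      ring
    calc P (N₁ ∪ N₂ ∪ ⋃ n, N₃ n) ≤ P N₁ + P N₂ + P (⋃ n, N₃ n) :=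
          (measure_union_le _ _).trans (add_le_add_left (measure_union_le _ _) _)
      _ ≤ 0 + ENNReal.ofReal (δ / 4) + ENNReal.ofReal (δ / 2) := by
          rw [hN₁]
          gcongr
      _ ≤ ENNReal.ofReal δ := by
          rw [zero_add, ← ENNReal.ofReal_add (by positivity) (by positivity)]
          exact ENNReal.ofReal_le_ofReal (by linarith)
  · simp only [Set.mem_union, Set.mem_iUnion, not_or, not_exists] at hω
    obtain ⟨⟨h1, h2⟩, h3⟩ := hω
    have hgrad : ∀ x ∈ D, HasGradientWithinAt (fun z => f z ω) (G x ω) D x := not_not.1 h1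
    have hGL : ∀ x ∈ D, ∀ j, |G x ω j| ≤ L := by
      intro x hx j
      have := not_lt.1 fun h => h2 ⟨j, h⟩
      have h4 := (le_iSup₂ (f := fun x (_ : x ∈ D) => ‖G x ω j‖ₑ) x hx).trans this
      rw [← ofReal_norm, ENNReal.ofReal_le_ofReal_iff hL] at h4
      exact h4
    have hlip : ∀ z ∈ D, ∀ z' ∈ D, f z ω - f z' ω ≤ √d * L * ‖z - z'‖ := fun z hz z' hz' =>
      (le_abs_self _).trans (abs_sub_le_of_gradient hconv hgrad hL hGL hz hz')
    have hx := hR.mem n ω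
    have hn : (0 : ℝ) < ((n : ℝ) + 1) ^ 2 := by positivity
    have hsd : √(d : ℝ) * √d = d := Real.mul_self_sqrt (Nat.cast_nonneg d)
    split_ifs with h
    · obtain ⟨z', hz', hzz⟩ := hnet n h z hz
      have h5 := not_lt.1 fun hb => h3 n ⟨h, Or.inl ⟨z', hz', hb⟩⟩
      have h6 := not_lt.1 fun hb => h3 n ⟨h, Or.inr hb⟩
      have h7 := hR.isMax n ω (hSD n h z' hz')
      simp only [Set.mem_ofPred_eq] at h7
      have h8 := hlip z hz z' (hSD n h z' hz')
      have h9 : √d * L * ‖z - z'‖ ≤ 1 / ((n : ℝ) + 1) ^ 2 := by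
        have hτ0 : 0 < τ (n + 1) := by linarith
        calc √d * L * ‖z - z'‖ ≤ √d * L * (√d * (r / τ (n + 1))) := by gcongr
          _ = (√d * √d) * L * r / τ (n + 1) := by ring
          _ = 1 / ((n : ℝ) + 1) ^ 2 := by
            rw [hsd, div_eq_div_iff hτ0.ne' hn.ne', hτL]
            ring
      linarith
    · have h8 := hlip z hz _ hx
      have h9 : ‖z - x n ω‖ ≤ √d * r := norm_le_of_coord hr.le fun j => by
        have h10 := hcube z hz j
        have h11 := hcube _ hx j
        rw [PiLp.sub_apply, abs_le]
        constructor <;> linarith [h10.1, h10.2, h11.1, h11.2]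
      have h12 : √d * L * ‖z - x n ω‖ ≤ 1 / ((n : ℝ) + 1) ^ 2 := by
        calc √d * L * ‖z - x n ω‖ ≤ √d * L * (√d * r) := by gcongr
          _ = (√d * √d) * L * r := by ring
          _ ≤ 1 / ((n : ℝ) + 1) ^ 2 := by
            rw [hsd, le_div_iff₀ hn]
            have := hτL n
            linarith [not_le.1 h]
      linarith

end GoodEvent

/-! ### From the good event to the regret bounds -/

section Regret

variable {d : ℕ} {a b r δ : ℝ}

/-- Concavity of the logarithm between `1` and `1 + c`. -/
lemma mul_log_le_log {u c : ℝ} (hu₀ : 0 ≤ u) (hu₁ : u ≤ 1) (hc : 0 < c) :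
    u * Real.log (1 + c) ≤ Real.log (1 + u * c) := by
  have h := strictConcaveOn_log_Ioi.concaveOn.2 (x := 1) (y := 1 + c) (by simp)
    (by simp only [Set.mem_Ioi]; linarith) (sub_nonneg.2 hu₁) hu₀ (by ring)
  simp only [smul_eq_mul, Real.log_one, mul_zero, zero_add] at h
  refine h.trans_eq ?_
  congr 1
  ring

/-- The constant in the bound of `β_t` by `d log (d t + 1)`. -/
noncomputable def betaConst (a b r δ : ℝ) : ℝ :=
  8 + 2 * |Real.log (Real.pi ^ 2 / (3 * δ))| / Real.log 2 +
    2 * |Real.log (b * r * (1 + 4 * a / δ))| / Real.log 2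

/-- `β_t ≤ C d log (d t + 1)`. Constants are absorbed by `log (d t + 1) ≥ log 2`, and the iterated
logarithm in `τ_t` is bounded crudely by its argument. -/
lemma beta_le (ha : 0 < a) (hb : 0 < b) (hr : 0 < r) (hδ : 0 < δ) (hd : 1 ≤ d) {t : ℕ} (ht : 1 ≤ t)
    (hτ : 1 ≤ resolution d a b r δ t) :
    beta d a b r δ t ≤ betaConst a b r δ * d * Real.log (d * t + 1) := by
  have hd' : (1 : ℝ) ≤ d := by exact_mod_cast hd
  have ht' : (1 : ℝ) ≤ t := by exact_mod_cast ht
  have hdt : (1 : ℝ) ≤ d * t := one_le_mul_of_one_le_of_one_le hd' ht'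
  have hlog2 : 0 < Real.log 2 := Real.log_pos one_lt_two
  set ℓ := Real.log (d * t + 1)
  have hℓ : Real.log 2 ≤ ℓ := Real.log_le_log two_pos (by linarith)
  have hℓ0 : 0 < ℓ := by linarith
  have hlt : Real.log t ≤ ℓ := Real.log_le_log (by linarith) (by nlinarith)
  have hldt : Real.log (d * t) ≤ ℓ := Real.log_le_log (by linarith) (by linarith)
  have habs : ∀ κ : ℝ, κ ≤ |κ| / Real.log 2 * ℓ := fun κ => by
    calc κ ≤ |κ| / Real.log 2 * Real.log 2 := by
          rw [div_mul_cancel₀ _ hlog2.ne']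
          exact le_abs_self κ
      _ ≤ |κ| / Real.log 2 * ℓ := by gcongr
  set κ₁ := Real.log (Real.pi ^ 2 / (3 * δ)) with hκ₁
  set κ₂ := Real.log (b * r * (1 + 4 * a / δ)) with hκ₂
  have h1 : Real.log ((t : ℝ) ^ 2 * Real.pi ^ 2 / (3 * δ)) = 2 * Real.log t + κ₁ := by
    rw [mul_div_assoc, Real.log_mul (by positivity) (by positivity), Real.log_pow]
    push_cast
    rfl
  have hsqrt : √(Real.log (4 * d * a / δ)) ≤ d * (1 + 4 * a / δ) := by
    have hu : 0 < 4 * d * a / δ := by positivity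
    have hl : Real.log (4 * d * a / δ) ≤ 4 * d * a / δ := (Real.log_le_sub_one_of_pos hu).trans
      (by linarith)
    refine Real.sqrt_le_iff.2 ⟨by positivity, hl.trans ?_⟩
    have e : 4 * d * a / δ = d * (4 * a / δ) := by ring
    have hq : 0 < 4 * a / δ := by positivity
    rw [e]
    have h0 : (d : ℝ) * (4 * a / δ) ≤ d * (1 + 4 * a / δ) := by gcongr; linarith
    have h2 : 1 ≤ d * (1 + 4 * a / δ) := one_le_mul_of_one_le_of_one_le hd' (by linarith)
    nlinarith
  have h2 : Real.log (resolution d a b r δ t) ≤ 2 * Real.log (d * t) + κ₂ := by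
    have : resolution d a b r δ t ≤ (d * t) ^ 2 * (b * r * (1 + 4 * a / δ)) := by
      calc resolution d a b r δ t ≤ (t : ℝ) ^ 2 * d * b * r * (d * (1 + 4 * a / δ)) := by
            unfold resolution
            gcongr
        _ = _ := by ring
    refine (Real.log_le_log (by linarith) this).trans_eq ?_
    rw [Real.log_mul (by positivity) (by positivity), Real.log_pow]
    push_cast
    rfl
  have h3 : beta d a b r δ t = 2 * Real.log ((t : ℝ) ^ 2 * Real.pi ^ 2 / (3 * δ)) +
    2 * d * Real.log (resolution d a b r δ t) := rfl
  set A := |κ₁| / Real.log 2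
  set B := |κ₂| / Real.log 2
  have hA : κ₁ ≤ A * ℓ := habs κ₁
  have hB : κ₂ ≤ B * ℓ := habs κ₂
  have hA0 : 0 ≤ A := by positivity
  have h4 : Real.log ((t : ℝ) ^ 2 * Real.pi ^ 2 / (3 * δ)) ≤ d * ((2 + A) * ℓ) := by
    rw [h1]
    have : (2 + A) * ℓ ≤ d * ((2 + A) * ℓ) := le_mul_of_one_le_left (by positivity) hd'
    linarith
  have h5 : d * Real.log (resolution d a b r δ t) ≤ d * ((2 + B) * ℓ) := by
    gcongr
    linarith
  rw [h3]
  calc _ ≤ 2 * (d * ((2 + A) * ℓ)) + 2 * (d * ((2 + B) * ℓ)) := by linarith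
    _ = betaConst a b r δ * d * ℓ := by
      simp only [betaConst, A, B]
      ring

/-- Widths `s n ≤ 1` whose information gains sum to at most `γ` have a small sum, by Cauchy–Schwarz
and concavity of the logarithm. -/
lemma sum_width_le {s : ℕ → ℝ} {β c γ : ℝ} {T : ℕ} (hβ : 0 ≤ β) (hc : 0 < c)
    (hs₁ : ∀ n, s n ^ 2 ≤ 1)
    (hγ : ∑ n ∈ Finset.range T, Real.log (1 + s n ^ 2 * c) / 2 ≤ γ) :
    ∑ n ∈ Finset.range T, 2 * (√β * s n) ≤ √(8 / Real.log (1 + c) * T * β * γ) := by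
  have hl : 0 < Real.log (1 + c) := Real.log_pos (by linarith)
  have hsq : ∑ n ∈ Finset.range T, s n ^ 2 ≤ 2 * γ / Real.log (1 + c) := by
    rw [le_div_iff₀ hl, Finset.sum_mul]
    calc ∑ n ∈ Finset.range T, s n ^ 2 * Real.log (1 + c)
        ≤ ∑ n ∈ Finset.range T, Real.log (1 + s n ^ 2 * c) :=
          Finset.sum_le_sum fun n _ => mul_log_le_log (sq_nonneg _) (hs₁ n) hc
      _ ≤ 2 * γ := by
          rw [← Finset.sum_div] at hγ
          linarith
  refine Real.le_sqrt_of_sq_le ?_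
  have hcs := sq_sum_le_card_mul_sum_sq (s := Finset.range T) (f := s)
  rw [Finset.card_range] at hcs
  rw [← Finset.mul_sum, ← Finset.mul_sum]
  calc (2 * (√β * ∑ n ∈ Finset.range T, s n)) ^ 2
      = 4 * β * (∑ n ∈ Finset.range T, s n) ^ 2 := by
        rw [mul_pow, mul_pow, Real.sq_sqrt hβ]
        ring
    _ ≤ 4 * β * (T * (2 * γ / Real.log (1 + c))) := by
        gcongr
        exact hcs.trans (by gcongr)
    _ = 8 / Real.log (1 + c) * T * β * γ := by ring

variable {Ω : Type*} [MeasurableSpace Ω] {P : Measure Ω} [IsProbabilityMeasure P]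
  {f : Pt d → Ω → ℝ} {ε : ℕ → Ω → ℝ} {D : Set (Pt d)} {k : Pt d → Pt d → ℝ} {σ : ℝ}
  {G : Pt d → Ω → Pt d} {pol : (n : ℕ) → (Fin n → Pt d × ℝ) → Pt d} {x : ℕ → Ω → Pt d}
  {y : ℕ → Ω → ℝ}

omit [MeasurableSpace Ω] in
lemma regret_eq_zero {β : ℕ → ℝ} (hR : IsRun f ε D k σ β pol x y) (hD : D.Subsingleton) (T : ℕ)
    (ω : Ω) : regret f D x T ω = 0 := by
  refine Finset.sum_eq_zero fun n _ => ?_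
  have : D = {x n ω} := hD.eq_singleton_of_mem (hR.mem n ω)
  rw [this, Set.image_singleton, csSup_singleton, sub_self]

/-- On an outcome with good per-round bounds, the regret is at most `π² / 6` plus the contribution
of the confidence widths; the latter is absent as long as `τ_T < 1`. -/
lemma regret_le (hb : 0 < b) (hr : 0 < r) (hδ₀ : 0 < δ) (hδ₁ : δ < 1)
    (hσ : 0 < σ) (hD : IsCompact D) (hconv : Convex ℝ D) (hnt : D.Nontrivial)
    (hM : IsGPModel P f ε D k σ) (hcont : ∀ᵐ ω ∂P, ContinuousOn (fun z => f z ω) D)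
    (hk : ∀ z ∈ D, k z z ≤ 1) (hR : IsRun f ε D k σ (beta d a b r δ) pol x y) {ω : Ω}
    (hω : ∀ n, ∀ z ∈ D, f z ω - f (x n ω) ω ≤ (if 1 ≤ resolution d a b r δ (n + 1) then
        2 * (√(beta d a b r δ (n + 1)) * postSD k σ (fun i : Fin n => x i ω) (x n ω)) else 0) +
          1 / ((n : ℝ) + 1) ^ 2) {T : ℕ} (hT : 1 ≤ T) :
    regret f D x T ω ≤ (if 1 ≤ resolution d a b r δ T then
      √(8 / Real.log (1 + (σ ^ 2)⁻¹) * T * beta d a b r δ T *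
        (maxInfoGain P f ε D T).toReal) else 0) + Real.pi ^ 2 / 6 := by
  set s : ℕ → ℝ := fun n => postSD k σ (fun i : Fin n => x i ω) (x n ω)
  have hterm : ∀ n, sSup ((fun z => f z ω) '' D) - f (x n ω) ω ≤
      (if 1 ≤ resolution d a b r δ (n + 1) then 2 * (√(beta d a b r δ (n + 1)) * s n) else 0) +
        1 / ((n : ℝ) + 1) ^ 2 := by
    intro n
    rw [sub_le_iff_le_add]
    refine csSup_le (hnt.nonempty.image _) ?_
    rintro _ ⟨z, hz, rfl⟩
    rw [← sub_le_iff_le_add]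
    exact hω n z hz
  have hbasel : ∑ n ∈ Finset.range T, 1 / ((n : ℝ) + 1) ^ 2 ≤ Real.pi ^ 2 / 6 := by
    have h := hasSum_inv_sq_succ 1
    simp only [one_mul] at h
    exact sum_le_hasSum _ (fun n _ => by positivity) h
  have hmono : ∀ n ∈ Finset.range T, resolution d a b r δ (n + 1) ≤ resolution d a b r δ T :=
    fun n hn => resolution_mono hb hr (Finset.mem_range.1 hn)
  refine (Finset.sum_le_sum fun n _ => hterm n).trans ?_
  rw [Finset.sum_add_distrib]
  refine add_le_add ?_ hbasel
  split_ifs with hτ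
  · have : Nonempty D := hnt.nonempty.to_subtype
    have hev := isGPEval_path hM hcont
    have : IsProbabilityMeasure (P.map fun ω (x : D) => f x ω) :=
      Measure.isProbabilityMeasure_map (measurable_path hM).aemeasurable
    set X : ℕ → D := fun n => ⟨x n ω, hR.mem n ω⟩
    have hs₂ : ∀ n, s n ^ 2 = postVar k σ (fun i : Fin n => (X i : Pt d)) (X n) := fun n =>
      Real.sq_sqrt (hev.postVar_nonneg hσ (fun i : Fin n => X i) (X n))
    have hs₁ : ∀ n, s n ^ 2 ≤ 1 := fun n => by
      rw [hs₂]
      exact (hev.postVar_le hσ _ _).trans (hk _ (X n).2)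
    have hγ := sum_log_le_maxInfoGain hM hcont hσ hD hconv hnt hk X T
    simp only [← hs₂, div_eq_mul_inv _ (σ ^ 2)] at hγ
    have hs₀ : ∀ n, 0 ≤ s n := fun n => Real.sqrt_nonneg _
    refine le_trans (Finset.sum_le_sum fun n hn => ?_) (sum_width_le
      (beta_nonneg hδ₀ hδ₁ hT hτ) (by positivity) hs₁ hγ)
    split_ifs with h
    · have := hs₀ n
      have := beta_le_beta hb hr hδ₀ (by omega) (Finset.mem_range.1 hn) h
      gcongr
    · have := hs₀ n
      positivity
  · refine (Finset.sum_eq_zero fun n hn => if_neg fun h => hτ (h.trans (hmono n hn))).le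

end Regret

end GPUCB

theorem theoremB6 (a b r δ σ v : ℝ) (ha : 0 < a) (hb : 0 < b) (hr : 0 < r)
    (hδ₀ : 0 < δ) (hδ₁ : δ < 1) (hσ : 0 < σ) (hv : 0 < v) :
    ∃ C : ℝ, 0 < C ∧
      ∀ (d : ℕ) (D : Set (GPUCB.Pt d)), IsCompact D → Convex ℝ D →
        (∀ x ∈ D, ∀ j, x j ∈ Set.Icc 0 r) →
      ∀ {Ω : Type*} [MeasurableSpace Ω] (P : Measure Ω) [IsProbabilityMeasure P]
        (k : GPUCB.Pt d → GPUCB.Pt d → ℝ) (f : GPUCB.Pt d → Ω → ℝ) (ε : ℕ → Ω → ℝ)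
        (G : GPUCB.Pt d → Ω → GPUCB.Pt d)
        (pol : (n : ℕ) → (Fin n → GPUCB.Pt d × ℝ) → GPUCB.Pt d)
        (x : ℕ → Ω → GPUCB.Pt d) (y : ℕ → Ω → ℝ),
        GPUCB.IsGPModel P f ε D k σ →
        (∀ z ∈ D, k z z ≤ 1) →
        GPUCB.HasPartialTails P f G D a b →
        GPUCB.IsRun f ε D k σ (GPUCB.beta d a b r δ) pol x y →
        ENNReal.ofReal (1 - δ) ≤ P {ω | ∀ T : ℕ, 1 ≤ T →
          GPUCB.regret f D x T ω ≤
              2 * √(8 / Real.log (1 + (σ ^ 2)⁻¹) * T * GPUCB.beta d a b r δ T *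
                (GPUCB.maxInfoGain P f ε D T).toReal) + Real.pi ^ 2 / 6 ∧
          ((∃ z ∈ D, v ≤ k z z) →
            GPUCB.regret f D x T ω ≤
              C * √(d * T * (GPUCB.maxInfoGain P f ε D T).toReal) *
                √(Real.log (d * T + 1)))} := by
  have hlog2 : 0 < Real.log 2 := Real.log_pos one_lt_two
  have hc : 0 < Real.log (1 + (σ ^ 2)⁻¹) := Real.log_pos (by
    have : 0 < (σ ^ 2)⁻¹ := by positivity
    linarith)
  have hg : 0 < Real.log (1 + v / σ ^ 2) := Real.log_pos (by
    have : 0 < v / σ ^ 2 := by positivity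
    linarith)
  set g := Real.log (1 + v / σ ^ 2) / 2
  set C₁ := 8 / Real.log (1 + (σ ^ 2)⁻¹)
  have hg0 : 0 < g := by positivity
  have hC₁ : 0 < C₁ := by positivity
  have hK : 0 ≤ GPUCB.betaConst a b r δ := by unfold GPUCB.betaConst; positivity
  refine ⟨√(C₁ * GPUCB.betaConst a b r δ) + Real.pi ^ 2 / 6 / √(g * Real.log 2), by positivity, ?_⟩
  intro d D hD hconv hcube Ω _ P _ k f ε G pol x y hM hk hT hR
  obtain ⟨N, hN, hgood⟩ :=
    GPUCB.exists_good_event ha hb hr hδ₀ hδ₁ hσ hD hconv hcube hM hT hR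
  have hcont : ∀ᵐ ω ∂P, ContinuousOn (fun z => f z ω) D := by
    filter_upwards [hT.hasGradient] with ω hω z hz using (hω z hz).continuousWithinAt
  have hP : ENNReal.ofReal (1 - δ) ≤ P Nᶜ := by
    rw [ENNReal.ofReal_sub _ hδ₀.le, ENNReal.ofReal_one, tsub_le_iff_right]
    calc 1 = P (Nᶜ ∪ N) := by rw [Set.compl_union_self, measure_univ]
      _ ≤ P Nᶜ + P N := measure_union_le _ _
      _ ≤ P Nᶜ + ENNReal.ofReal δ := by gcongr
  refine hP.trans (measure_mono fun ω hω T hT1 => ?_)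
  set γ := (GPUCB.maxInfoGain P f ε D T).toReal
  set β := GPUCB.beta d a b r δ T
  rcases D.subsingleton_or_nontrivial with hsub | hnt
  · rw [GPUCB.regret_eq_zero hR hsub]
    exact ⟨by positivity, fun _ => by positivity⟩
  have hreg := GPUCB.regret_le hb hr hδ₀ hδ₁ hσ hD hconv hnt hM hcont hk hR (hgood ω hω) hT1
  refine ⟨hreg.trans ?_, fun ⟨z, hz, hvz⟩ => ?_⟩
  · have : 0 ≤ √(C₁ * T * β * γ) := Real.sqrt_nonneg _
    split_ifs <;> linarith
  -- A domain with two points has positive dimension.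
  have hd : 1 ≤ d := by
    by_contra h
    obtain rfl : d = 0 := by omega
    exact Set.not_subsingleton_iff.2 hnt Set.subsingleton_of_subsingleton
  have hd' : (1 : ℝ) ≤ d := by exact_mod_cast hd
  have hT' : (1 : ℝ) ≤ T := by exact_mod_cast hT1
  have hdT : (1 : ℝ) ≤ d * T := one_le_mul_of_one_le_of_one_le hd' hT'
  have hγ : g ≤ γ := GPUCB.log_le_maxInfoGain hM hcont hσ hD hconv hnt hk hz hv hvz hT1
  have hγ0 : 0 < γ := hg0.trans_le hγ
  set ℓ := Real.log (d * T + 1)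
  have hℓ : Real.log 2 ≤ ℓ := Real.log_le_log two_pos (by linarith)
  have hℓ0 : 0 < ℓ := hlog2.trans_le hℓ
  refine hreg.trans ?_
  rw [add_mul, add_mul]
  refine add_le_add ?_ ?_
  · split_ifs with hτ
    · have hβ := GPUCB.beta_le ha hb hr hδ₀ hd hT1 hτ
      rw [← Real.sqrt_mul (by positivity), ← Real.sqrt_mul (by positivity)]
      refine Real.sqrt_le_sqrt ?_
      calc C₁ * T * β * γ ≤ C₁ * T * (GPUCB.betaConst a b r δ * d * ℓ) * γ := by gcongr
        _ = C₁ * GPUCB.betaConst a b r δ * (d * T * γ) * ℓ := by ring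
    · positivity
  · have h1 : √(g * Real.log 2) ≤ √(d * T * γ) * √ℓ := by
      rw [← Real.sqrt_mul (by positivity)]
      refine Real.sqrt_le_sqrt ?_
      gcongr
      nlinarith
    have h2 : 0 < √(g * Real.log 2) := by positivity
    rw [mul_assoc, div_mul_eq_mul_div, le_div_iff₀ h2]
    gcongr
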